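/- Let $\lambda_i,\mu_i,\nu_i$ ($i=1,2,3,4$) be real numbers with $$\lambda_1=-\lambda_2,\quad \mu_1=-\mu_4,\quad \mu_2=-\mu_3,\quad \lambda_3=-\lambda_4,$$ $$\frac{\nu_1^2}{\lambda_1\mu_1}=\frac{\nu_3^2}{\lambda_3\mu_3},\qquad \frac{\nu_2^2}{\lambda_2\mu_2}=\frac{\nu_4^2}{\lambda_4\mu_4},\qquad \frac{\nu_1^2}{\lambda_1\mu_1}+\frac{\nu_2^2}{\lambda_2\mu_2}=16,$$ and $\lambda_1,\mu_1>0$, $\lambda_3,\mu_3<0$. Consider the system $$(z^2+\lambda_1)(w_1^2+\mu_1)=\nu_1zw_1,\qquad (z^2-\lambda_1)(w_2^2-\mu_3)=\nu_2zw_2,$$ $$(u^2+\lambda_3)(w_2^2+\mu_3)=\nu_3uw_2,\qquad (u^2-\lambda_3)(w_1^2-\mu_1)=\nu_4uw_1,$$ in unknowns $z,w_1,u,w_2\in\mathbb{R}P^1=\mathbb R\cup\{\infty\}$ (each equation being read bihomogeneously). A non-trivial one-parametric family of solutions is a continuous curve of solutions along which none of $z,w_1,u,w_2$ is constant. Put $\zeta_1=\dfrac{|\nu_1|}{4\sqrt{\lambda_1\mu_1}}$.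 (a) The system has a real non-trivial one-parametric family of solutions if and only if $\zeta_1>1$. (b) Suppose $\zeta_1>1$. Let $k=\bigl(\zeta_1-\sqrt{\zeta_1^2-1}\bigr)^2$, $k'=\sqrt{1-k^2}$, let $K=K(k)$ and $K'=K(k')$ be the complete elliptic integrals of the first kind, and let $\operatorname{sn}=\operatorname{sn}(\cdot,k)$ be the Jacobi elliptic sine, as a meromorphic function on $\mathbb C$ with values in $\mathbb C\cup\{\infty\}$. Then the set of all real solutions consists of four branches, which, up to the symmetry $(z,w_1,u,w_2)\mapsto-(z,w_1,u,w_2)$, are given by $$\begin{cases} z=\operatorname{sgn}\nu_1\cdot\sqrt{\lambda_1k}\,\operatorname{sn}(K+it),\\ w_1=\sqrt{\mu_1k}\,\operatorname{sn}\bigl(K+\tfrac{iK'}2+it\bigr),\\ u=i\operatorname{sgn}\nu_4\cdot\sqrt{-\lambda_3k}\,\operatorname{sn}\bigl(K+\tfrac{iK'}2\pm\operatorname{sgn}(\nu_1\nu_2)\bigl(K-\tfrac{iK'}2\bigr)+it\bigr),\\ w_2=i\operatorname{sgn}(\nu_1\nu_2)\cdot\sqrt{-\mu_3k}\,\operatorname{sn}\bigl(K\mp\operatorname{sgn}(\nu_3\nu_4)\bigl(K-\tfrac{iK'}2\bigr)+it\bigr),\end{cases}$$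 where $t\in[0,2K')$ is the parameter and the upper or the lower signs are taken simultaneously in $u$ and $w_2$. Each of the four branches is a non-trivial one-parametric family, and every real solution lies on exactly one of the four branches, for exactly one value of $t\in[0,2K')$. -/

import Mathlib

open Set

noncomputable section

/-! ### Jacobi's elliptic sine -/

/-- Legendre's incomplete elliptic integral of the first kind
`F(φ, k) = ∫₀^φ dθ / √(1 - k² sin² θ)`. -/
def ellipticF (k φ : ℝ) : ℝ := ∫ θ in (0 : ℝ)..φ, (√(1 - k ^ 2 * Real.sin θ ^ 2))⁻¹

/-- The complete elliptic integral of the first kind `K(k)`. -/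
def ellipticK (k : ℝ) : ℝ := ellipticF k (Real.pi / 2)

/-- The complementary modulus `k' = √(1 - k²)`. -/
def compModulus (k : ℝ) : ℝ := √(1 - k ^ 2)

/-- For `k² < 1` the function `F(·, k)` is a bijection of the real line, so that the
amplitude below is its genuine inverse. -/
theorem ellipticF_bijective {k : ℝ} (hk : k ^ 2 < 1) : Function.Bijective (ellipticF k) := by
  have hpos : ∀ θ : ℝ, 0 < 1 - k ^ 2 * Real.sin θ ^ 2 := fun θ => by
    nlinarith [Real.sin_sq_le_one θ, sq_nonneg k, sq_nonneg (Real.sin θ)]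
  have hcont : Continuous fun θ : ℝ => (√(1 - k ^ 2 * Real.sin θ ^ 2))⁻¹ :=
    Continuous.inv₀ (by fun_prop) fun θ => (Real.sqrt_pos.2 (hpos θ)).ne'
  have hint : ∀ a b : ℝ, IntervalIntegrable
      (fun θ : ℝ => (√(1 - k ^ 2 * Real.sin θ ^ 2))⁻¹) MeasureTheory.volume a b :=
    fun a b => hcont.intervalIntegrable a b
  have hone : ∀ θ : ℝ, 1 ≤ (√(1 - k ^ 2 * Real.sin θ ^ 2))⁻¹ := fun θ => by
    refine (one_le_inv₀ (Real.sqrt_pos.2 (hpos θ))).2 (Real.sqrt_le_one.2 ?_)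
    nlinarith [mul_nonneg (sq_nonneg k) (sq_nonneg (Real.sin θ))]
  have hgrow : ∀ a b : ℝ, a ≤ b → b - a ≤ ellipticF k b - ellipticF k a := fun a b hab => by
    have h1 : ellipticF k b - ellipticF k a
        = ∫ θ in a..b, (√(1 - k ^ 2 * Real.sin θ ^ 2))⁻¹ :=
      intervalIntegral.integral_interval_sub_left (hint 0 b) (hint 0 a)
    have h2 : ∫ _θ in a..b, (1 : ℝ) ≤ ∫ θ in a..b, (√(1 - k ^ 2 * Real.sin θ ^ 2))⁻¹ :=
      intervalIntegral.integral_mono_on hab (by simp) (hint a b) fun θ _ => hone θ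
    rw [h1]
    simpa using h2
  have h0 : ellipticF k 0 = 0 := by simp [ellipticF]
  have hc : Continuous (ellipticF k) := intervalIntegral.continuous_primitive hint 0
  refine ⟨StrictMono.injective fun a b hab => ?_, hc.surjective ?_ ?_⟩
  · have := hgrow a b hab.le
    linarith
  · refine Filter.tendsto_atTop_mono' _ ?_ Filter.tendsto_id
    filter_upwards [Filter.eventually_ge_atTop (0 : ℝ)] with b hb
    have := hgrow 0 b hb
    simp only [id]
    linarith
  · refine Filter.tendsto_atBot_mono' _ ?_ Filter.tendsto_id
    filter_upwards [Filter.eventually_le_atBot (0 : ℝ)] with a ha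
    have := hgrow a 0 ha
    simp only [id]
    linarith

/-- Jacobi's amplitude `am(x, k)`: the inverse of `φ ↦ F(φ, k)`. -/
def jacobiAm (k x : ℝ) : ℝ := Function.invFun (ellipticF k) x

/-- `sn(x, k)` for real `x`. -/
def realSn (k x : ℝ) : ℝ := Real.sin (jacobiAm k x)

/-- `cn(x, k)` for real `x`. -/
def realCn (k x : ℝ) : ℝ := Real.cos (jacobiAm k x)

/-- `dn(x, k)` for real `x`. -/
def realDn (k x : ℝ) : ℝ := √(1 - k ^ 2 * realSn k x ^ 2)

open Classical in
/-- The elliptic sine `sn(·, k)`, `0 < k < 1`, as a meromorphic function on `ℂ` with values in the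
Riemann sphere `OnePoint ℂ`.  With `s, c, d` the values of `sn, cn, dn` at `(x, k)`
and `s₁, c₁, d₁` those at `(y, k')`, Jacobi's imaginary transformation and the addition theorem give
`sn(x + i y, k) = (s d₁ + i c d s₁ c₁) / (c₁² + k² s² s₁²)`,
and the poles are the zeros of the denominator. -/
def jacobiSn (k : ℝ) (v : ℂ) : OnePoint ℂ :=
  let s := realSn k v.re
  let c := realCn k v.re
  let d := realDn k v.re
  let s₁ := realSn (compModulus k) v.im
  let c₁ := realCn (compModulus k) v.im
  let d₁ := realDn (compModulus k) v.im
  let D := c₁ ^ 2 + k ^ 2 * s ^ 2 * s₁ ^ 2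
  if D = 0 then OnePoint.infty
  else (((((s * d₁ : ℝ) : ℂ) + ((c * d * s₁ * c₁ : ℝ) : ℂ) * Complex.I) / (D : ℂ) : ℂ) : OnePoint ℂ)

/-! ### The polynomial system over the real projective line `ℝ ∪ {∞}` -/

/-- First homogeneous coordinate: `x = [x : 1]` for real `x`, and `∞ = [1 : 0]`. -/
def homNum (x : OnePoint ℝ) : ℝ := x.elim 1 id

/-- Second homogeneous coordinate: `x = [x : 1]` for real `x`, and `∞ = [1 : 0]`. -/
def homDen (x : OnePoint ℝ) : ℝ := x.elim 0 fun _ => 1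

/-- The bihomogeneous form of the equation `(x² + lam)(y² + mu) - nu x y = 0`. -/
def BiquadraticEq (lam mu nu : ℝ) (x y : OnePoint ℝ) : Prop :=
  (homNum x ^ 2 + lam * homDen x ^ 2) * (homNum y ^ 2 + mu * homDen y ^ 2)
    - nu * (homNum x * homDen x) * (homNum y * homDen y) = 0

/-- At finite points the bihomogeneous equation is the original one. -/
theorem biquadraticEq_coe (lam mu nu x y : ℝ) :
    BiquadraticEq lam mu nu (x : OnePoint ℝ) (y : OnePoint ℝ)
      ↔ (x ^ 2 + lam) * (y ^ 2 + mu) - nu * x * y = 0 := by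
  simp [BiquadraticEq, homNum, homDen]

/-- The set of real solutions `(z, w₁, u, w₂)` of the system
`(z² + λ₁)(w₁² + μ₁) = ν₁ z w₁`, `(z² - λ₁)(w₂² - μ₃) = ν₂ z w₂`,
`(u² + λ₃)(w₂² + μ₃) = ν₃ u w₂`, `(u² - λ₃)(w₁² - μ₁) = ν₄ u w₁`. -/
def solutionSet (lam₁ mu₁ lam₃ mu₃ nu₁ nu₂ nu₃ nu₄ : ℝ) :
    Set (OnePoint ℝ × OnePoint ℝ × OnePoint ℝ × OnePoint ℝ) :=
  {p | match p with
    | (z, w₁, u, w₂) =>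
      BiquadraticEq lam₁ mu₁ nu₁ z w₁ ∧
      BiquadraticEq (-lam₁) (-mu₃) nu₂ z w₂ ∧
      BiquadraticEq lam₃ mu₃ nu₃ u w₂ ∧
      BiquadraticEq (-lam₃) (-mu₁) nu₄ u w₁}

/-- A non-trivial one-parametric family over the parameter set `I`: a continuous curve
none of whose four coordinates is constant. -/
def IsNontrivialCurveOn {X : Type*} [TopologicalSpace X] (γ : ℝ → X × X × X × X) (I : Set ℝ) :
    Prop :=
  ContinuousOn γ I ∧
  ((fun t => (γ t).1) '' I).Nontrivial ∧
  ((fun t => (γ t).2.1) '' I).Nontrivial ∧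
  ((fun t => (γ t).2.2.1) '' I).Nontrivial ∧
  ((fun t => (γ t).2.2.2) '' I).Nontrivial

/-- The set `S` contains a non-trivial one-parametric family. -/
def HasNontrivialCurve {X : Type*} [TopologicalSpace X] (S : Set (X × X × X × X)) : Prop :=
  ∃ γ : ℝ → X × X × X × X, IsNontrivialCurveOn γ (Icc 0 1) ∧ ∀ t ∈ Icc (0 : ℝ) 1, γ t ∈ S

/-- The inclusion of `ℝ ∪ {∞}` into the Riemann sphere `ℂ ∪ {∞}`. -/
def toSphere (x : OnePoint ℝ) : OnePoint ℂ := OnePoint.map (fun r : ℝ => (r : ℂ)) x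

/-- The coordinatewise inclusion of quadruples. -/
def toSphere4 (p : OnePoint ℝ × OnePoint ℝ × OnePoint ℝ × OnePoint ℝ) :
    OnePoint ℂ × OnePoint ℂ × OnePoint ℂ × OnePoint ℂ :=
  (toSphere p.1, toSphere p.2.1, toSphere p.2.2.1, toSphere p.2.2.2)

/-! ### The elliptic parameterization -/

/-- Multiplication by `a ≠ 0` on the Riemann sphere (fixing `∞`). -/
def sphereMul (a : ℂ) (x : OnePoint ℂ) : OnePoint ℂ := OnePoint.map (fun y : ℂ => a * y) x

/-- Coordinatewise multiplication of a quadruple by `a ≠ 0`. -/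
def sphereMul4 (a : ℂ) (p : OnePoint ℂ × OnePoint ℂ × OnePoint ℂ × OnePoint ℂ) :
    OnePoint ℂ × OnePoint ℂ × OnePoint ℂ × OnePoint ℂ :=
  (sphereMul a p.1, sphereMul a p.2.1, sphereMul a p.2.2.1, sphereMul a p.2.2.2)

/-- The branch `t ↦ (z, w₁, u, w₂)` with modulus `k`, where `σ = ±1` is the upper or lower choice
of the signs `±` in `u` and `∓` in `w₂`. -/
def ellipticBranch (lam₁ mu₁ lam₃ mu₃ nu₁ nu₂ nu₃ nu₄ k σ t : ℝ) :
    OnePoint ℂ × OnePoint ℂ × OnePoint ℂ × OnePoint ℂ :=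
  let K : ℂ := (ellipticK k : ℂ)
  let K' : ℂ := (ellipticK (compModulus k) : ℂ)
  let i : ℂ := Complex.I
  let sgn : ℝ → ℂ := fun x => (Real.sign x : ℂ)
  (sphereMul (sgn nu₁ * (√(lam₁ * k) : ℝ)) (jacobiSn k (K + i * t)),
   sphereMul ((√(mu₁ * k) : ℝ)) (jacobiSn k (K + i * K' / 2 + i * t)),
   sphereMul (i * sgn nu₄ * (√(-lam₃ * k) : ℝ))
    (jacobiSn k (K + i * K' / 2 + σ * sgn (nu₁ * nu₂) * (K - i * K' / 2) + i * t)),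
   sphereMul (i * sgn (nu₁ * nu₂) * (√(-mu₃ * k) : ℝ))
    (jacobiSn k (K - σ * sgn (nu₃ * nu₄) * (K - i * K' / 2) + i * t)))

end

/-!
# Real solutions of the coupled biquadratic system

Write `lam₁ = a²`, `mu₁ = b²`, `lam₃ = -c²`, `mu₃ = -e²` and `k = r²`, so that
`ζ₁ = (r + 1/r) / 2` and `√(ζ₁² - 1) = (1/r - r) / 2`. After scaling the unknowns by `±a, ±b, ±c, ±e`
the system reads, up to one sign,
`(Z + 1/Z)(W + 1/W) = 2 (1/r + r)`, `(Z - 1/Z)(V + 1/V) = -2 (1/r - r)`,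
`(U - 1/U)(V - 1/V) = ∓2 (1/r + r)`, `(U + 1/U)(W - 1/W) = 2 (1/r - r)`.

The first equation cuts out an oval in the positive quadrant. With `s = sin φ`, `c = cos φ`,
`d = √(1 - (1 - r⁴) s²)` it is parametrized by `Z = r / d`, `W = D / A`, where `D = c² + r² s²` and
`A = d - (1 - r²) s c`; conversely `cos 2φ` and `sin 2φ` are rational in `(Z, W)`, and the equation
of the oval says exactly that they lie on the unit circle (`exists_amplitude`). So the oval is the
circle `φ ∈ [0, π)`. Over each of its points the equations for `U` and for `V` have two mutually
inverse roots each, `r s / c` and `(r² s + c d) / (c - s d)` among them (`fibre_u_iff`,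
`fibre_w_iff`). The equation linking `U` and `V` holds for two of the four combinations
(`fibre_link`), and these two never coincide (`fibre_ne`); another combination satisfies it only
where `U` or `V` equals its own inverse, and then it is one of the two. This gives two disjoint
branches over the oval, and the symmetry `(z, w₁, u, w₂) ↦ -(z, w₁, u, w₂)` makes them four
(`bijOn_realBranch`).

The elliptic formulas enter through `φ = am(t, k')`, a bijection `[0, 2K') → [0, π)`. On the vertical
lines with real part `0`, `K`, `2K` the function `sn(·, k)` is expressed by `sn`, `cn`, `dn` of the
imaginary part with modulus `k'`. The shifts of `t` by `K'` and `±K'/2` are then evaluated by the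
addition theorem, which follows from the differential equations: with `x + y` held fixed, the
right-hand side of the addition formula has zero derivative. The result is `ellipticBranch_eq`.

The hypotheses force `ζ₁ ≥ 1`. If `ζ₁ = 1` then `nu₂ = 0`, hence `z² = lam₁`, and `z` is constant
along each curve of solutions.
-/

/-! ### Jacobi's elliptic functions of a real variable -/

theorem one_sub_mul_sin_sq_pos {k : ℝ} (hk : k ^ 2 < 1) (θ : ℝ) :
    0 < 1 - k ^ 2 * Real.sin θ ^ 2 := by
  nlinarith [Real.sin_sq_le_one θ, sq_nonneg k, sq_nonneg (Real.sin θ)]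

theorem continuous_ellipticF_integrand {k : ℝ} (hk : k ^ 2 < 1) :
    Continuous fun θ : ℝ => (√(1 - k ^ 2 * Real.sin θ ^ 2))⁻¹ :=
  Continuous.inv₀ (by fun_prop) fun θ => (Real.sqrt_pos.2 (one_sub_mul_sin_sq_pos hk θ)).ne'

theorem hasDerivAt_ellipticF {k : ℝ} (hk : k ^ 2 < 1) (φ : ℝ) :
    HasDerivAt (ellipticF k) (√(1 - k ^ 2 * Real.sin φ ^ 2))⁻¹ φ :=
  (continuous_ellipticF_integrand hk).integral_hasStrictDerivAt 0 φ |>.hasDerivAt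

theorem strictMono_ellipticF {k : ℝ} (hk : k ^ 2 < 1) : StrictMono (ellipticF k) := by
  refine strictMono_of_deriv_pos fun φ => ?_
  rw [(hasDerivAt_ellipticF hk φ).deriv]
  exact inv_pos.2 (Real.sqrt_pos.2 (one_sub_mul_sin_sq_pos hk φ))

@[simp] theorem ellipticF_zero (k : ℝ) : ellipticF k 0 = 0 := by simp [ellipticF]

theorem ellipticF_neg (k φ : ℝ) : ellipticF k (-φ) = -ellipticF k φ := by
  have h := intervalIntegral.integral_comp_neg (a := 0) (b := φ)
    (fun θ : ℝ => (√(1 - k ^ 2 * Real.sin θ ^ 2))⁻¹)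
  simp only [Real.sin_neg, neg_sq, neg_zero] at h
  rw [ellipticF, ellipticF, intervalIntegral.integral_symm, h]

theorem ellipticF_pi {k : ℝ} (hk : k ^ 2 < 1) : ellipticF k Real.pi = 2 * ellipticK k := by
  have hint := (continuous_ellipticF_integrand hk).intervalIntegrable (μ := MeasureTheory.volume)
  have h := intervalIntegral.integral_comp_sub_left (a := 0) (b := Real.pi / 2)
    (fun θ : ℝ => (√(1 - k ^ 2 * Real.sin θ ^ 2))⁻¹) Real.pi
  simp only [Real.sin_pi_sub, sub_zero, sub_half] at h
  rw [ellipticK, ellipticF, ← intervalIntegral.integral_add_adjacent_intervals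
    (hint 0 (Real.pi / 2)) (hint (Real.pi / 2) Real.pi), ← h, ellipticF, two_mul]

theorem ellipticK_pos {k : ℝ} (hk : k ^ 2 < 1) : 0 < ellipticK k := by
  simpa [ellipticK] using strictMono_ellipticF hk Real.pi_div_two_pos

theorem jacobiAm_ellipticF {k : ℝ} (hk : k ^ 2 < 1) (φ : ℝ) : jacobiAm k (ellipticF k φ) = φ :=
  Function.leftInverse_invFun (ellipticF_bijective hk).1 φ

theorem ellipticF_jacobiAm {k : ℝ} (hk : k ^ 2 < 1) (x : ℝ) : ellipticF k (jacobiAm k x) = x :=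
  Function.rightInverse_invFun (ellipticF_bijective hk).2 x

theorem jacobiAm_zero {k : ℝ} (hk : k ^ 2 < 1) : jacobiAm k 0 = 0 := by
  simpa using jacobiAm_ellipticF hk 0

theorem jacobiAm_ellipticK {k : ℝ} (hk : k ^ 2 < 1) : jacobiAm k (ellipticK k) = Real.pi / 2 :=
  jacobiAm_ellipticF hk _

theorem jacobiAm_two_mul_ellipticK {k : ℝ} (hk : k ^ 2 < 1) :
    jacobiAm k (2 * ellipticK k) = Real.pi := by
  rw [← ellipticF_pi hk, jacobiAm_ellipticF hk]

theorem jacobiAm_neg {k : ℝ} (hk : k ^ 2 < 1) (x : ℝ) : jacobiAm k (-x) = -jacobiAm k x := by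
  apply (ellipticF_bijective hk).1
  rw [ellipticF_neg, ellipticF_jacobiAm hk, ellipticF_jacobiAm hk]

theorem strictMono_jacobiAm {k : ℝ} (hk : k ^ 2 < 1) : StrictMono (jacobiAm k) := fun x y h => by
  rwa [← (strictMono_ellipticF hk).lt_iff_lt, ellipticF_jacobiAm hk, ellipticF_jacobiAm hk]

theorem continuous_jacobiAm {k : ℝ} (hk : k ^ 2 < 1) : Continuous (jacobiAm k) :=
  (strictMono_jacobiAm hk).monotone.continuous_of_surjective fun φ =>
    ⟨_, jacobiAm_ellipticF hk φ⟩

theorem bijOn_jacobiAm {k : ℝ} (hk : k ^ 2 < 1) :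
    BijOn (jacobiAm k) (Ico 0 (2 * ellipticK k)) (Ico 0 Real.pi) := by
  refine ⟨fun x hx => ⟨?_, ?_⟩, (strictMono_jacobiAm hk).injective.injOn,
    fun φ hφ => ⟨ellipticF k φ, ⟨?_, ?_⟩, jacobiAm_ellipticF hk φ⟩⟩
  · rw [← jacobiAm_zero hk]
    exact (strictMono_jacobiAm hk).monotone hx.1
  · rw [← jacobiAm_two_mul_ellipticK hk]
    exact strictMono_jacobiAm hk hx.2
  · rw [← ellipticF_zero k]
    exact (strictMono_ellipticF hk).monotone hφ.1
  · rw [← ellipticF_pi hk]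
    exact strictMono_ellipticF hk hφ.2

theorem realSn_sq_add_realCn_sq (k x : ℝ) : realSn k x ^ 2 + realCn k x ^ 2 = 1 :=
  Real.sin_sq_add_cos_sq _

theorem realDn_pos {k : ℝ} (hk : k ^ 2 < 1) (x : ℝ) : 0 < realDn k x :=
  Real.sqrt_pos.2 (one_sub_mul_sin_sq_pos hk _)

theorem realDn_sq {k : ℝ} (hk : k ^ 2 < 1) (x : ℝ) :
    realDn k x ^ 2 = 1 - k ^ 2 * realSn k x ^ 2 :=
  Real.sq_sqrt (one_sub_mul_sin_sq_pos hk _).le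

theorem hasDerivAt_jacobiAm {k : ℝ} (hk : k ^ 2 < 1) (x : ℝ) :
    HasDerivAt (jacobiAm k) (realDn k x) x := by
  have h := (hasDerivAt_ellipticF hk (jacobiAm k x)).of_local_left_inverse
    (continuous_jacobiAm hk).continuousAt (inv_pos.2 (realDn_pos hk x)).ne'
    (Filter.Eventually.of_forall (ellipticF_jacobiAm hk))
  rwa [inv_inv] at h

theorem hasDerivAt_realSn {k : ℝ} (hk : k ^ 2 < 1) (x : ℝ) :
    HasDerivAt (realSn k) (realCn k x * realDn k x) x :=
  (hasDerivAt_jacobiAm hk x).sin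

theorem hasDerivAt_realCn {k : ℝ} (hk : k ^ 2 < 1) (x : ℝ) :
    HasDerivAt (realCn k) (-realSn k x * realDn k x) x :=
  (hasDerivAt_jacobiAm hk x).cos

theorem hasDerivAt_realDn {k : ℝ} (hk : k ^ 2 < 1) (x : ℝ) :
    HasDerivAt (realDn k) (-k ^ 2 * realSn k x * realCn k x) x := by
  have h := ((((hasDerivAt_realSn hk x).pow 2).const_mul (k ^ 2)).const_sub 1).sqrt
    (one_sub_mul_sin_sq_pos hk _).ne'
  refine h.congr_deriv ?_
  have h0 := (realDn_pos hk x).ne'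
  change -(k ^ 2 * (2 * realSn k x ^ (2 - 1) * (realCn k x * realDn k x))) / (2 * realDn k x) = _
  field_simp
  ring

theorem realSn_zero {k : ℝ} (hk : k ^ 2 < 1) : realSn k 0 = 0 := by
  simp [realSn, jacobiAm_zero hk]

theorem realCn_zero {k : ℝ} (hk : k ^ 2 < 1) : realCn k 0 = 1 := by
  simp [realCn, jacobiAm_zero hk]

theorem realDn_zero {k : ℝ} (hk : k ^ 2 < 1) : realDn k 0 = 1 := by
  simp [realDn, realSn_zero hk]

theorem realSn_ellipticK {k : ℝ} (hk : k ^ 2 < 1) : realSn k (ellipticK k) = 1 := by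
  simp [realSn, jacobiAm_ellipticK hk]

theorem realCn_ellipticK {k : ℝ} (hk : k ^ 2 < 1) : realCn k (ellipticK k) = 0 := by
  simp [realCn, jacobiAm_ellipticK hk]

theorem realSn_two_mul_ellipticK {k : ℝ} (hk : k ^ 2 < 1) : realSn k (2 * ellipticK k) = 0 := by
  simp [realSn, jacobiAm_two_mul_ellipticK hk]

theorem realCn_two_mul_ellipticK {k : ℝ} (hk : k ^ 2 < 1) : realCn k (2 * ellipticK k) = -1 := by
  simp [realCn, jacobiAm_two_mul_ellipticK hk]

theorem realSn_neg {k : ℝ} (hk : k ^ 2 < 1) (x : ℝ) : realSn k (-x) = -realSn k x := by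
  simp [realSn, jacobiAm_neg hk]

theorem realCn_neg {k : ℝ} (hk : k ^ 2 < 1) (x : ℝ) : realCn k (-x) = realCn k x := by
  simp [realCn, jacobiAm_neg hk]

theorem realDn_neg {k : ℝ} (hk : k ^ 2 < 1) (x : ℝ) : realDn k (-x) = realDn k x := by
  simp [realDn, realSn_neg hk]

/-! ### The addition theorem -/

theorem addition_denominator_pos {k : ℝ} (hk : k ^ 2 < 1) (x y : ℝ) :
    0 < 1 - k ^ 2 * realSn k x ^ 2 * realSn k y ^ 2 := by
  have h1 : realSn k x ^ 2 ≤ 1 := Real.sin_sq_le_one _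
  have h2 : realSn k y ^ 2 ≤ 1 := Real.sin_sq_le_one _
  have h3 : k ^ 2 * realSn k x ^ 2 ≤ k ^ 2 := mul_le_of_le_one_right (sq_nonneg _) h1
  have h4 : k ^ 2 * realSn k x ^ 2 * realSn k y ^ 2 ≤ k ^ 2 * realSn k x ^ 2 :=
    mul_le_of_le_one_right (by positivity) h2
  linarith

/-- A quotient with vanishing Wronskian `N' D - N D'` is constant. -/
theorem div_eq_div_of_wronskian_eq_zero {N D N' D' : ℝ → ℝ} (hN : ∀ x, HasDerivAt N (N' x) x)
    (hD : ∀ x, HasDerivAt D (D' x) x) (h0 : ∀ x, D x ≠ 0)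
    (hW : ∀ x, N' x * D x - N x * D' x = 0) (x y : ℝ) : N x / D x = N y / D y := by
  have h : ∀ x, HasDerivAt (fun x => N x / D x) 0 x := fun x => by
    refine ((hN x).div (hD x) (h0 x)).congr_deriv ?_
    rw [hW x, zero_div]
  exact is_const_of_deriv_eq_zero (fun x => (h x).differentiableAt) (fun x => (h x).deriv) x y

theorem hasDerivAt_addition_denominator {k : ℝ} (hk : k ^ 2 < 1) (w x : ℝ) :
    HasDerivAt (fun x => 1 - k ^ 2 * realSn k x ^ 2 * realSn k (w - x) ^ 2)
      (-2 * k ^ 2 * (realSn k x * realSn k (w - x) *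
        (realSn k (w - x) * realCn k x * realDn k x
          - realSn k x * realCn k (w - x) * realDn k (w - x)))) x := by
  have hs := hasDerivAt_realSn hk x
  have hs' := (hasDerivAt_realSn hk (w - x)).comp_const_sub w x
  refine ((((hs.pow 2).const_mul (k ^ 2)).mul (hs'.pow 2)).const_sub 1).congr_deriv ?_
  simp only [Pi.pow_apply]
  ring

/-- The addition theorem for `sn`: with `x + y` fixed, the right-hand side does not depend on `x`,
and at `x = 0` it is `sn (x + y)`. -/
theorem realSn_add {k : ℝ} (hk : k ^ 2 < 1) (x y : ℝ) :
    realSn k (x + y) = (realSn k x * realCn k y * realDn k y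
      + realSn k y * realCn k x * realDn k x) / (1 - k ^ 2 * realSn k x ^ 2 * realSn k y ^ 2) := by
  have h := div_eq_div_of_wronskian_eq_zero
    (fun t => ((((hasDerivAt_realSn hk t).mul ((hasDerivAt_realCn hk (x + y - t)).comp_const_sub
      (x + y) t)).mul ((hasDerivAt_realDn hk (x + y - t)).comp_const_sub (x + y) t)).add
      ((((hasDerivAt_realSn hk (x + y - t)).comp_const_sub (x + y) t).mul
        (hasDerivAt_realCn hk t)).mul (hasDerivAt_realDn hk t))))
    (hasDerivAt_addition_denominator hk (x + y))
    (fun t => (addition_denominator_pos hk _ _).ne') (fun t => ?_) 0 x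
  · simp only [Pi.add_apply, Pi.mul_apply, sub_zero, add_sub_cancel_left, realSn_zero hk,
      realCn_zero hk, realDn_zero hk] at h
    rw [← h]
    ring
  · simp only [Pi.add_apply, Pi.mul_apply]
    have h1 := realSn_sq_add_realCn_sq k t
    have h2 := realSn_sq_add_realCn_sq k (x + y - t)
    have h3 := realDn_sq hk t
    have h4 := realDn_sq hk (x + y - t)
    generalize realSn k t = s at *
    generalize realCn k t = c at *
    generalize realDn k t = d at *
    generalize realSn k (x + y - t) = s' at *
    generalize realCn k (x + y - t) = c' at *
    generalize realDn k (x + y - t) = d' at *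
    grind

theorem realCn_add {k : ℝ} (hk : k ^ 2 < 1) (x y : ℝ) :
    realCn k (x + y) = (realCn k x * realCn k y
      - realSn k x * realSn k y * realDn k x * realDn k y)
        / (1 - k ^ 2 * realSn k x ^ 2 * realSn k y ^ 2) := by
  have h := div_eq_div_of_wronskian_eq_zero
    (fun t => ((hasDerivAt_realCn hk t).mul ((hasDerivAt_realCn hk (x + y - t)).comp_const_sub
      (x + y) t)).sub ((((hasDerivAt_realSn hk t).mul
        ((hasDerivAt_realSn hk (x + y - t)).comp_const_sub (x + y) t)).mul
        (hasDerivAt_realDn hk t)).mul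
        ((hasDerivAt_realDn hk (x + y - t)).comp_const_sub (x + y) t)))
    (hasDerivAt_addition_denominator hk (x + y))
    (fun t => (addition_denominator_pos hk _ _).ne') (fun t => ?_) 0 x
  · simp only [Pi.sub_apply, Pi.mul_apply, sub_zero, add_sub_cancel_left, realSn_zero hk,
      realCn_zero hk, realDn_zero hk] at h
    rw [← h]
    ring
  · simp only [Pi.sub_apply, Pi.mul_apply]
    have h1 := realSn_sq_add_realCn_sq k t
    have h2 := realSn_sq_add_realCn_sq k (x + y - t)
    have h3 := realDn_sq hk t
    have h4 := realDn_sq hk (x + y - t)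
    generalize realSn k t = s at *
    generalize realCn k t = c at *
    generalize realDn k t = d at *
    generalize realSn k (x + y - t) = s' at *
    generalize realCn k (x + y - t) = c' at *
    generalize realDn k (x + y - t) = d' at *
    grind

theorem realDn_add {k : ℝ} (hk : k ^ 2 < 1) (x y : ℝ) :
    realDn k (x + y) = (realDn k x * realDn k y
      - k ^ 2 * (realSn k x * realSn k y * realCn k x * realCn k y))
        / (1 - k ^ 2 * realSn k x ^ 2 * realSn k y ^ 2) := by
  have h := div_eq_div_of_wronskian_eq_zero
    (fun t => ((hasDerivAt_realDn hk t).mul ((hasDerivAt_realDn hk (x + y - t)).comp_const_sub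
      (x + y) t)).sub (((((hasDerivAt_realSn hk t).mul
        ((hasDerivAt_realSn hk (x + y - t)).comp_const_sub (x + y) t)).mul
        (hasDerivAt_realCn hk t)).mul
        ((hasDerivAt_realCn hk (x + y - t)).comp_const_sub (x + y) t)).const_mul (k ^ 2)))
    (hasDerivAt_addition_denominator hk (x + y))
    (fun t => (addition_denominator_pos hk _ _).ne') (fun t => ?_) 0 x
  · simp only [Pi.sub_apply, Pi.mul_apply, sub_zero, add_sub_cancel_left, realSn_zero hk,
      realCn_zero hk, realDn_zero hk] at h
    rw [← h]
    ring
  · simp only [Pi.sub_apply, Pi.mul_apply]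
    have h1 := realSn_sq_add_realCn_sq k t
    have h2 := realSn_sq_add_realCn_sq k (x + y - t)
    have h3 := realDn_sq hk t
    have h4 := realDn_sq hk (x + y - t)
    generalize realSn k t = s at *
    generalize realCn k t = c at *
    generalize realDn k t = d at *
    generalize realSn k (x + y - t) = s' at *
    generalize realCn k (x + y - t) = c' at *
    generalize realDn k (x + y - t) = d' at *
    grind

/-! ### Homogeneous coordinates on the real projective line -/

/-- The point `[x : y]` of the real projective line.  It is meaningful when `(x, y) ≠ (0, 0)`. -/
noncomputable def homPoint (x y : ℝ) : OnePoint ℝ :=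
  if y = 0 then OnePoint.infty else ((x / y : ℝ) : OnePoint ℝ)

theorem homPoint_of_ne (x : ℝ) {y : ℝ} (hy : y ≠ 0) : homPoint x y = ((x / y : ℝ) : OnePoint ℝ) :=
  if_neg hy

@[simp] theorem homPoint_zero_right (x : ℝ) : homPoint x 0 = OnePoint.infty := if_pos rfl

theorem homPoint_mul_right (x y : ℝ) {g : ℝ} (hg : g ≠ 0) :
    homPoint (x * g) (y * g) = homPoint x y := by
  by_cases hy : y = 0
  · simp [hy]
  · rw [homPoint_of_ne _ hy, homPoint_of_ne _ (mul_ne_zero hy hg), mul_div_mul_right _ _ hg]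

theorem homPoint_eq_homPoint_iff {x y x' y' : ℝ} (h : x ≠ 0 ∨ y ≠ 0) (h' : x' ≠ 0 ∨ y' ≠ 0) :
    homPoint x y = homPoint x' y' ↔ x * y' = x' * y := by
  by_cases hy : y = 0 <;> by_cases hy' : y' = 0
  · simp [hy, hy']
  · have hx : x ≠ 0 := h.resolve_right (not_not.2 hy)
    simp [hy, hy', homPoint_of_ne, hx]
  · have hx : x' ≠ 0 := h'.resolve_right (not_not.2 hy')
    simp [hy, hy', homPoint_of_ne, hx]
  · rw [homPoint_of_ne _ hy, homPoint_of_ne _ hy', OnePoint.coe_eq_coe, div_eq_div_iff hy hy']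

/-- Every point has homogeneous coordinates, and the first one may be rescaled at will. -/
theorem exists_eq_homPoint_mul (p : OnePoint ℝ) {a : ℝ} (ha : a ≠ 0) :
    ∃ x y : ℝ, (x ≠ 0 ∨ y ≠ 0) ∧ p = homPoint (a * x) y := by
  induction p using OnePoint.rec with
  | infty => exact ⟨1, 0, by simp, by simp⟩
  | coe x => exact ⟨x / a, 1, by simp, by rw [homPoint_of_ne _ one_ne_zero]; field_simp⟩

theorem mul_ne_zero_or {a x y : ℝ} (ha : a ≠ 0) (h : x ≠ 0 ∨ y ≠ 0) : a * x ≠ 0 ∨ y ≠ 0 :=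
  h.imp_left (mul_ne_zero ha)

theorem exists_homNum_homDen_homPoint {x y : ℝ} (h : x ≠ 0 ∨ y ≠ 0) :
    ∃ g : ℝ, g ≠ 0 ∧ x = g * homNum (homPoint x y) ∧ y = g * homDen (homPoint x y) := by
  by_cases hy : y = 0
  · exact ⟨x, h.resolve_right (not_not.2 hy), by simp [hy, homNum], by simp [hy, homDen]⟩
  · refine ⟨y, hy, ?_, ?_⟩ <;> rw [homPoint_of_ne _ hy]
    · change x = y * (x / y)
      field_simp
    · exact (mul_one y).symm

theorem biquadraticEq_homPoint_iff (lam mu nu : ℝ) {x y x' y' : ℝ} (h : x ≠ 0 ∨ y ≠ 0)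
    (h' : x' ≠ 0 ∨ y' ≠ 0) : BiquadraticEq lam mu nu (homPoint x y) (homPoint x' y') ↔
      (x ^ 2 + lam * y ^ 2) * (x' ^ 2 + mu * y' ^ 2) - nu * (x * y) * (x' * y') = 0 := by
  obtain ⟨g, hg, hx, hy⟩ := exists_homNum_homDen_homPoint h
  obtain ⟨g', hg', hx', hy'⟩ := exists_homNum_homDen_homPoint h'
  rw [BiquadraticEq]
  generalize homPoint x y = p at *
  generalize homPoint x' y' = p' at *
  subst hx hy hx' hy'
  rw [← mul_eq_zero_iff_left (pow_ne_zero 2 (mul_ne_zero hg hg'))]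
  ring_nf

/-- The coefficients of the equation are normalized by rescaling the two unknowns. -/
theorem biquadraticEq_homPoint_mul_iff {a b : ℝ} (η θ ν : ℝ) {lam mu nu : ℝ} {x y x' y' : ℝ}
    (ha : a ≠ 0) (hb : b ≠ 0) (hlam : lam = η * a ^ 2) (hmu : mu = θ * b ^ 2) (hnu : nu = a * b * ν)
    (h : x ≠ 0 ∨ y ≠ 0) (h' : x' ≠ 0 ∨ y' ≠ 0) :
    BiquadraticEq lam mu nu (homPoint (a * x) y) (homPoint (b * x') y') ↔
      (x ^ 2 + η * y ^ 2) * (x' ^ 2 + θ * y' ^ 2) = ν * (x * y) * (x' * y') := by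
  rw [biquadraticEq_homPoint_iff _ _ _ (mul_ne_zero_or ha h) (mul_ne_zero_or hb h'), hlam, hmu, hnu,
    ← sub_eq_zero (b := ν * (x * y) * (x' * y')),
    ← mul_eq_zero_iff_left (pow_ne_zero 2 (mul_ne_zero ha hb))
      (b := (x ^ 2 + η * y ^ 2) * (x' ^ 2 + θ * y' ^ 2) - ν * (x * y) * (x' * y'))]
  ring_nf

theorem continuousAt_homPoint {x y : ℝ} (h : x ≠ 0 ∨ y ≠ 0) :
    ContinuousAt (fun p : ℝ × ℝ => homPoint p.1 p.2) (x, y) := by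
  by_cases hy : y = 0
  · have hx : x ≠ 0 := h.resolve_right (not_not.2 hy)
    subst hy
    rw [ContinuousAt, homPoint_zero_right, OnePoint.hasBasis_nhds_infty.tendsto_right_iff]
    rintro K ⟨-, hK⟩
    obtain ⟨R, hR⟩ := hK.isBounded.exists_norm_le
    -- near `(x, 0)` one has `R |q| < |p|`, hence `p / q` leaves the ball of radius `R`
    have hev : ∀ᶠ p : ℝ × ℝ in nhds (x, 0), R * |p.2| < |p.1| :=
      ContinuousAt.eventually_lt (by fun_prop) (by fun_prop) (by simpa using hx)
    filter_upwards [hev] with p hp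
    by_cases hq : p.2 = 0
    · simp [hq]
    · rw [homPoint_of_ne _ hq]
      refine Or.inl ⟨p.1 / p.2, fun hmem => ?_, rfl⟩
      have := hR _ hmem
      rw [Real.norm_eq_abs, abs_div, div_le_iff₀ (abs_pos.2 hq)] at this
      linarith
  · have hev : (fun p : ℝ × ℝ => homPoint p.1 p.2) =ᶠ[nhds (x, y)]
        fun p => ((p.1 / p.2 : ℝ) : OnePoint ℝ) := by
      filter_upwards [continuousAt_snd.eventually_ne hy] with p hp using homPoint_of_ne _ hp
    refine ContinuousAt.congr ?_ hev.symm
    exact OnePoint.continuous_coe.continuousAt.comp (continuousAt_fst.div continuousAt_snd hy)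

theorem continuous_homPoint_comp {f g : ℝ → ℝ} (hf : Continuous f) (hg : Continuous g)
    (h : ∀ t, f t ≠ 0 ∨ g t ≠ 0) : Continuous fun t => homPoint (f t) (g t) :=
  continuous_iff_continuousAt.2 fun t =>
    ContinuousAt.comp (f := fun t => (f t, g t)) (continuousAt_homPoint (h t))
      (hf.prodMk hg).continuousAt

theorem toSphere_homPoint (x y : ℝ) : toSphere (homPoint x y) =
    if y = 0 then OnePoint.infty else (((x : ℂ) / (y : ℂ) : ℂ) : OnePoint ℂ) := by
  by_cases hy : y = 0
  · simp [hy, toSphere]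
  · simp [hy, toSphere, homPoint_of_ne]

theorem sphereMul_toSphere_homPoint (ε x y : ℝ) :
    sphereMul ε (toSphere (homPoint x y)) = toSphere (homPoint (ε * x) y) := by
  rw [toSphere_homPoint, toSphere_homPoint]
  by_cases hy : y = 0
  · simp [hy, sphereMul]
  · simp [hy, sphereMul, mul_div_assoc]

theorem continuous_toSphere : Continuous toSphere :=
  OnePoint.continuous_map Complex.continuous_ofReal
    (by simpa only [Filter.coclosedCompact_eq_cocompact] using
      Complex.isometry_ofReal.isClosedEmbedding.tendsto_cocompact)

theorem injective_toSphere : Function.Injective toSphere :=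
  Option.map_injective Complex.ofReal_injective

theorem injective_toSphere4 : Function.Injective toSphere4 := by
  rintro ⟨a, b, c, d⟩ ⟨a', b', c', d'⟩ h
  simp only [toSphere4, Prod.mk.injEq] at h
  obtain ⟨h1, h2, h3, h4⟩ := h
  rw [injective_toSphere h1, injective_toSphere h2, injective_toSphere h3, injective_toSphere h4]

theorem continuous_toSphere4 : Continuous toSphere4 := by
  have := continuous_toSphere
  unfold toSphere4
  fun_prop

theorem IsNontrivialCurveOn.map_toSphere4
    {γ : ℝ → OnePoint ℝ × OnePoint ℝ × OnePoint ℝ × OnePoint ℝ} {I : Set ℝ}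
    (h : IsNontrivialCurveOn γ I) : IsNontrivialCurveOn (fun t => toSphere4 (γ t)) I := by
  obtain ⟨h0, h1, h2, h3, h4⟩ := h
  refine ⟨continuous_toSphere4.comp_continuousOn h0, ?_, ?_, ?_, ?_⟩
  · simpa only [image_image, toSphere4] using h1.image injective_toSphere
  · simpa only [image_image, toSphere4] using h2.image injective_toSphere
  · simpa only [image_image, toSphere4] using h3.image injective_toSphere
  · simpa only [image_image, toSphere4] using h4.image injective_toSphere

/-! ### The curve `(Z + 1/Z)(W + 1/W) = 2 (r + 1/r)` and its fibres -/

section algebra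

variable {r s c d : ℝ}

theorem sq_add_mul_sq_pos (hr : 0 < r) (hsc : s ^ 2 + c ^ 2 = 1) : 0 < c ^ 2 + r ^ 2 * s ^ 2 := by
  by_cases hs : s = 0
  · subst hs; nlinarith
  · positivity

theorem sub_mul_add_eq_sq (hsc : s ^ 2 + c ^ 2 = 1) (hd : d ^ 2 = 1 - (1 - r ^ 4) * s ^ 2) :
    (d - (1 - r ^ 2) * (s * c)) * (d + (1 - r ^ 2) * (s * c)) = (c ^ 2 + r ^ 2 * s ^ 2) ^ 2 := by
  grind

theorem sub_mul_pos (hr : 0 < r) (hsc : s ^ 2 + c ^ 2 = 1) (hd : d ^ 2 = 1 - (1 - r ^ 4) * s ^ 2)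
    (hd0 : 0 < d) : 0 < d - (1 - r ^ 2) * (s * c) := by
  have h1 := sub_mul_add_eq_sq hsc hd
  have h2 := pow_pos (sq_add_mul_sq_pos hr hsc) 2
  by_contra! h
  nlinarith

theorem num_sq_add_den_sq (hsc : s ^ 2 + c ^ 2 = 1) (hd : d ^ 2 = 1 - (1 - r ^ 4) * s ^ 2) :
    (r ^ 2 * s + c * d) ^ 2 + (c - s * d) ^ 2 = 2 * d * (d - (1 - r ^ 2) * (s * c)) := by
  grind

theorem num_sq_sub_den_sq (hsc : s ^ 2 + c ^ 2 = 1) (hd : d ^ 2 = 1 - (1 - r ^ 4) * s ^ 2) :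
    (r ^ 2 * s + c * d) ^ 2 - (c - s * d) ^ 2
      = 2 * (1 + r ^ 2) * (s * c) * (d - (1 - r ^ 2) * (s * c)) := by
  grind

theorem num_mul_den (hsc : s ^ 2 + c ^ 2 = 1) (hd : d ^ 2 = 1 - (1 - r ^ 4) * s ^ 2) :
    (1 - r ^ 2) * ((r ^ 2 * s + c * d) * (c - s * d))
      = (d ^ 2 - r ^ 2) * (d - (1 - r ^ 2) * (s * c)) := by
  grind

theorem num_ne_zero_or_den_ne_zero (hr : 0 < r) (hsc : s ^ 2 + c ^ 2 = 1)
    (hd : d ^ 2 = 1 - (1 - r ^ 4) * s ^ 2) (hd0 : 0 < d) :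
    r ^ 2 * s + c * d ≠ 0 ∨ c - s * d ≠ 0 := by
  by_contra! h
  have h1 := num_sq_add_den_sq hsc hd
  have h2 := sub_mul_pos hr hsc hd hd0
  rw [h.1, h.2] at h1
  have : 0 < 2 * d * (d - (1 - r ^ 2) * (s * c)) := by positivity
  linarith

theorem mul_sin_ne_zero_or_cos_ne_zero (hr : 0 < r) (hsc : s ^ 2 + c ^ 2 = 1) :
    r * s ≠ 0 ∨ c ≠ 0 := by
  by_contra! h
  have := sq_add_mul_sq_pos hr hsc
  rw [← mul_pow, h.1, h.2] at this
  simp at this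

/-- The point `(r / d, D / A)`, with `D = c² + r² s²` and `A = d - (1 - r²) s c`, lies on the
curve. -/
theorem base_curve_eq (hr : 0 < r) (hsc : s ^ 2 + c ^ 2 = 1)
    (hd : d ^ 2 = 1 - (1 - r ^ 4) * s ^ 2) :
    (r ^ 2 + 1 * d ^ 2) * ((c ^ 2 + r ^ 2 * s ^ 2) ^ 2 + 1 * (d - (1 - r ^ 2) * (s * c)) ^ 2)
      = 2 * (1 + r ^ 2) / r * (r * d) * ((c ^ 2 + r ^ 2 * s ^ 2) * (d - (1 - r ^ 2) * (s * c))) := by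
  rw [← sub_mul_add_eq_sq hsc hd]
  have h : r ^ 2 + 1 * d ^ 2 = (1 + r ^ 2) * (c ^ 2 + r ^ 2 * s ^ 2) := by grind
  rw [h]
  field_simp
  ring

/-- Over a point of the curve the equation for `[x : y] = u` has the two roots `[r s : c]` and
`[c : r s]`. -/
theorem fibre_u_iff (hr : 0 < r) (hr1 : r < 1) (hsc : s ^ 2 + c ^ 2 = 1)
    (hd : d ^ 2 = 1 - (1 - r ^ 4) * s ^ 2) (hd0 : 0 < d) (x y : ℝ) :
    (x ^ 2 + 1 * y ^ 2) * ((c ^ 2 + r ^ 2 * s ^ 2) ^ 2 + (-1) * (d - (1 - r ^ 2) * (s * c)) ^ 2)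
      = 2 * (1 - r ^ 2) / r * (x * y) *
        ((c ^ 2 + r ^ 2 * s ^ 2) * (d - (1 - r ^ 2) * (s * c)))
      ↔ x * c = r * s * y ∨ x * (r * s) = c * y := by
  have hA := sub_mul_pos hr hsc hd hd0
  have hr2 : 0 < 1 - r ^ 2 := by nlinarith
  rw [← sub_mul_add_eq_sq hsc hd, ← sub_eq_zero, ← sub_eq_zero (a := x * c),
    ← sub_eq_zero (a := x * (r * s)), ← mul_eq_zero,
    ← mul_eq_zero_iff_left (b := (x * c - r * s * y) * (x * (r * s) - c * y))
      (mul_pos (mul_pos two_pos hr2) (div_pos hA hr)).ne']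
  have : ∀ X Y : ℝ, X = Y → (X = 0 ↔ Y = 0) := fun X Y h => by rw [h]
  apply this
  field_simp
  ring

/-- Over a point of the curve the equation for `[x : y] = w₂` has the two roots `[p : q]` and
`[q : p]`, with `p = r² s + c d` and `q = c - s d`. -/
theorem fibre_w_iff (hr : 0 < r) (hr1 : r < 1) (hsc : s ^ 2 + c ^ 2 = 1)
    (hd : d ^ 2 = 1 - (1 - r ^ 4) * s ^ 2) (hd0 : 0 < d) (x y : ℝ) :
    (r ^ 2 + (-1) * d ^ 2) * (x ^ 2 + 1 * y ^ 2) = -(2 * (1 - r ^ 2) / r) * (r * d) * (x * y)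
      ↔ x * (c - s * d) = (r ^ 2 * s + c * d) * y ∨ x * (r ^ 2 * s + c * d) = (c - s * d) * y := by
  have hA := sub_mul_pos hr hsc hd hd0
  have hr2 : 0 < 1 - r ^ 2 := by nlinarith
  have h1 := num_sq_add_den_sq hsc hd
  have h2 := num_mul_den hsc hd
  have key : (d - (1 - r ^ 2) * (s * c)) *
      ((r ^ 2 + (-1) * d ^ 2) * (x ^ 2 + 1 * y ^ 2) - -(2 * (1 - r ^ 2) / r) * (r * d) * (x * y))
      = -(1 - r ^ 2) * ((x * (c - s * d) - (r ^ 2 * s + c * d) * y) *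
        (x * (r ^ 2 * s + c * d) - (c - s * d) * y)) := by
    have h3 : -(2 * (1 - r ^ 2) / r) * (r * d) * (x * y) = -2 * (1 - r ^ 2) * d * (x * y) := by
      field_simp
    rw [h3]
    linear_combination (-(1 - r ^ 2) * x * y) * h1 + (x ^ 2 + y ^ 2) * h2
  rw [← sub_eq_zero, ← sub_eq_zero (a := x * (c - s * d)),
    ← sub_eq_zero (a := x * (r ^ 2 * s + c * d)), ← mul_eq_zero,
    ← mul_eq_zero_iff_left (b := _ - -(2 * (1 - r ^ 2) / r) * (r * d) * (x * y)) hA.ne', key,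
    mul_eq_zero_iff_left (neg_ne_zero.2 hr2.ne')]

/-- The two roots `[r s : c]` and `[p : q]` are linked by the remaining equation. -/
theorem fibre_link (hr : 0 < r) (hsc : s ^ 2 + c ^ 2 = 1)
    (hd : d ^ 2 = 1 - (1 - r ^ 4) * s ^ 2) :
    ((r * s) ^ 2 + (-1) * c ^ 2) * ((r ^ 2 * s + c * d) ^ 2 + (-1) * (c - s * d) ^ 2)
      = -(2 * (1 + r ^ 2) / r) * (r * s * c) * ((r ^ 2 * s + c * d) * (c - s * d)) := by
  have h1 := num_sq_sub_den_sq hsc hd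
  have h3 : -(2 * (1 + r ^ 2) / r) * (r * s * c) * ((r ^ 2 * s + c * d) * (c - s * d))
      = -2 * (1 + r ^ 2) * (s * c) * ((r ^ 2 * s + c * d) * (c - s * d)) := by
    field_simp
  have h4 : (r ^ 2 * s + c * d) * (c - s * d)
      = (c ^ 2 - r ^ 2 * s ^ 2) * (d - (1 - r ^ 2) * (s * c)) := by grind
  rw [h3, h4]
  linear_combination (r ^ 2 * s ^ 2 - c ^ 2) * h1

/-- The two solutions over a point of the curve differ: `[r s : c]` and `[p : q]` are not both fixed
by the exchange of their homogeneous coordinates. -/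
theorem fibre_ne (hr : 0 < r) (hsc : s ^ 2 + c ^ 2 = 1)
    (hd : d ^ 2 = 1 - (1 - r ^ 4) * s ^ 2) (hd0 : 0 < d) (hu : (r * s) ^ 2 = c ^ 2)
    (hw : (r ^ 2 * s + c * d) ^ 2 = (c - s * d) ^ 2) : False := by
  have hA := sub_mul_pos hr hsc hd hd0
  have h := num_sq_sub_den_sq hsc hd
  rw [hw, sub_self, eq_comm, mul_eq_zero_iff_right hA.ne', mul_eq_zero_iff_left (by positivity)] at h
  rcases mul_eq_zero.1 h with h | h <;> subst h
  · simp at hu; simp [← hu] at hsc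
  · simp [hr.ne'] at hu; simp [hu] at hsc

end algebra

theorem exists_mem_Ico_cos_sin {x y : ℝ} (h : x ^ 2 + y ^ 2 = 1) :
    ∃ θ ∈ Ico (0 : ℝ) (2 * Real.pi), Real.cos θ = x ∧ Real.sin θ = y := by
  have hn : ‖(⟨x, y⟩ : ℂ)‖ = 1 := by
    rw [Complex.norm_eq_sqrt_sq_add_sq, h, Real.sqrt_one]
  have hz : (⟨x, y⟩ : ℂ) ≠ 0 := fun h0 => by simp [h0] at hn
  refine ⟨toIcoMod Real.two_pi_pos 0 (Complex.arg ⟨x, y⟩),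
    (by simpa using toIcoMod_mem_Ico Real.two_pi_pos 0 (Complex.arg ⟨x, y⟩)), ?_, ?_⟩
  · rw [toIcoMod, zsmul_eq_mul, Real.cos_sub_int_mul_two_pi, Complex.cos_arg hz, hn, div_one]
  · rw [toIcoMod, zsmul_eq_mul, Real.sin_sub_int_mul_two_pi, Complex.sin_arg, hn, div_one]

/-- `dn` as a function of the amplitude, for the modulus `√(1 - r⁴)` complementary to `r²`. -/
noncomputable def deltaAmp (r φ : ℝ) : ℝ := √(1 - (1 - r ^ 4) * Real.sin φ ^ 2)

section deltaAmp

variable {r : ℝ}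

theorem deltaAmp_radicand_pos (hr : 0 < r) (hr1 : r < 1) (φ : ℝ) :
    0 < 1 - (1 - r ^ 4) * Real.sin φ ^ 2 := by
  have h1 : r ^ 4 < 1 := pow_lt_one₀ hr.le hr1 four_ne_zero
  have h2 : 0 < r ^ 4 := by positivity
  nlinarith [Real.sin_sq_le_one φ, sq_nonneg (Real.sin φ)]

theorem deltaAmp_sq (hr : 0 < r) (hr1 : r < 1) (φ : ℝ) :
    deltaAmp r φ ^ 2 = 1 - (1 - r ^ 4) * Real.sin φ ^ 2 :=
  Real.sq_sqrt (deltaAmp_radicand_pos hr hr1 φ).le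

theorem deltaAmp_pos (hr : 0 < r) (hr1 : r < 1) (φ : ℝ) : 0 < deltaAmp r φ :=
  Real.sqrt_pos.2 (deltaAmp_radicand_pos hr hr1 φ)

theorem continuous_deltaAmp (r : ℝ) : Continuous (deltaAmp r) := by
  unfold deltaAmp
  fun_prop

end deltaAmp

/-- The amplitude parametrizes the positive part of the curve: `cos 2φ` and `sin 2φ` are rational
functions of `Z` and `W`, and the equation of the curve says that they lie on the unit circle. -/
theorem exists_amplitude {r Z W : ℝ} (hr : 0 < r) (hr1 : r < 1) (hZ : 0 < Z) (hW : 0 < W)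
    (h : (Z ^ 2 + 1) * (W ^ 2 + 1) = 2 * (1 + r ^ 2) / r * Z * W) :
    ∃ φ ∈ Ico 0 Real.pi, Z * deltaAmp r φ = r ∧
      W * (deltaAmp r φ - (1 - r ^ 2) * (Real.sin φ * Real.cos φ))
        = Real.cos φ ^ 2 + r ^ 2 * Real.sin φ ^ 2 := by
  have hr2 : 0 < 1 - r ^ 2 := by nlinarith
  have hr4 : 0 < 1 - r ^ 4 := by nlinarith
  obtain ⟨d, hd⟩ : ∃ d, d = r / Z := ⟨_, rfl⟩
  obtain ⟨q, hq⟩ : ∃ q, q = (1 - d ^ 2) / (1 - r ^ 4) := ⟨_, rfl⟩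
  obtain ⟨D, hD⟩ : ∃ D, D = 1 - (1 - r ^ 2) * q := ⟨_, rfl⟩
  have hd0 : 0 < d := hd ▸ div_pos hr hZ
  have hq' : d ^ 2 = 1 - (1 - r ^ 4) * q := by rw [hq]; field_simp; ring
  have hDd : (1 + r ^ 2) * D = r ^ 2 + d ^ 2 := by rw [hD, hq']; ring
  have hWD : (W ^ 2 + 1) * D = 2 * d * W := by
    have hZd : Z * d = r := by rw [hd]; field_simp
    have h' : r * ((Z ^ 2 + 1) * (W ^ 2 + 1)) = 2 * (1 + r ^ 2) * Z * W := by
      rw [h]; field_simp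
    apply mul_left_cancel₀ (mul_pos (by positivity : 0 < 1 + r ^ 2) (mul_pos hZ hr)).ne'
    subst hZd
    linear_combination (Z ^ 2 * d * (W ^ 2 + 1)) * hDd + Z * d ^ 2 * h'
  have hY : (2 * (((W ^ 2 - 1) * D) / (2 * W * (1 - r ^ 2)))) ^ 2 = 4 * q * (1 - q) := by
    have h1 : d ^ 2 - D ^ 2 = (1 - r ^ 2) ^ 2 * (q * (1 - q)) := by rw [hq', hD]; ring
    field_simp
    linear_combination ((W ^ 2 + 1) * D + 2 * d * W) * hWD + 4 * W ^ 2 * h1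
  obtain ⟨θ, hθ, hc, hs⟩ := exists_mem_Ico_cos_sin (x := 1 - 2 * q)
    (y := 2 * (((W ^ 2 - 1) * D) / (2 * W * (1 - r ^ 2)))) (by rw [hY]; ring)
  obtain ⟨φ, rfl⟩ : ∃ φ, θ = 2 * φ := ⟨θ / 2, by ring⟩
  rw [Real.sin_two_mul, mul_assoc, mul_right_inj' two_ne_zero] at hs
  rw [Real.cos_two_mul, Real.cos_sq'] at hc
  have hsq : Real.sin φ ^ 2 = q := by linarith
  have hcq : Real.cos φ ^ 2 = 1 - q := by rw [Real.cos_sq', hsq]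
  have hdφ : deltaAmp r φ = d := by
    rw [deltaAmp, hsq, ← hq', Real.sqrt_sq hd0.le]
  refine ⟨φ, ⟨by linarith [hθ.1], by linarith [hθ.2]⟩, ?_, ?_⟩
  · rw [hdφ, hd]; field_simp
  · rw [hdφ, hs, hsq, hcq]
    have : 1 - q + r ^ 2 * q = D := by rw [hD]; ring
    rw [this]
    field_simp
    linear_combination -hWD

/-- An amplitude in `[0, π)` is determined by `sin² φ` and `sin φ cos φ`. -/
theorem amplitude_injective {φ ψ : ℝ} (hφ : φ ∈ Ico 0 Real.pi) (hψ : ψ ∈ Ico 0 Real.pi)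
    (h1 : Real.sin φ ^ 2 = Real.sin ψ ^ 2)
    (h2 : Real.sin φ * Real.cos φ = Real.sin ψ * Real.cos ψ) : φ = ψ := by
  have h : Real.sin (φ - ψ) = 0 := by
    have h3 := Real.sin_sq_add_cos_sq φ
    have h4 := Real.sin_sq_add_cos_sq ψ
    rw [Real.sin_sub, ← sq_eq_zero_iff]
    grind
  have h5 := (Real.sin_eq_zero_iff_of_lt_of_lt (by linarith [hφ.1, hψ.2])
    (by linarith [hφ.2, hψ.1])).1 h
  linarith

/-! ### The solution set in terms of the amplitude -/

/-- The real form of the branch of solutions, as a function of the amplitude `φ`.  Here `α, β, γ, δ`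
are the (signed) scales of the unknowns `z, w₁, u, w₂`, the modulus is `r²`, and the propositions
`P` and `Q` select one of two mutually inverse values for `u / γ` and for `w₂ / δ`. -/
noncomputable def realBranch (α β γ δ r : ℝ) (P Q : Prop) [Decidable P] [Decidable Q] (φ : ℝ) :
    OnePoint ℝ × OnePoint ℝ × OnePoint ℝ × OnePoint ℝ :=
  let s := Real.sin φ
  let c := Real.cos φ
  let d := deltaAmp r φ
  (homPoint (α * r) d,
   homPoint (β * (c ^ 2 + r ^ 2 * s ^ 2)) (d - (1 - r ^ 2) * (s * c)),
   if P then homPoint (γ * (r * s)) c else homPoint (γ * c) (r * s),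
   if Q then homPoint (δ * (r ^ 2 * s + c * d)) (c - s * d)
    else homPoint (δ * (c - s * d)) (r ^ 2 * s + c * d))

theorem exists_eq_mul_of_cross_eq {x y t c : ℝ} (h0 : t ≠ 0 ∨ c ≠ 0) (h : x * c = t * y) :
    ∃ g, x = g * t ∧ y = g * c := by
  rcases h0 with h0 | h0
  · exact ⟨x / t, by field_simp, by field_simp; linarith⟩
  · exact ⟨y / c, by field_simp; linarith, by field_simp⟩

/-- If `[x : y] = [t : c]` equals its own inverse then it also equals `[c : t]`. -/
theorem cross_swap {x y t c : ℝ} (h0 : x ≠ 0 ∨ y ≠ 0) (h : x * c = t * y) (hxy : x ^ 2 = y ^ 2) :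
    x * t = c * y := by
  rcases h0 with h0 | h0 <;> apply mul_left_cancel₀ h0
  · linear_combination t * hxy - y * h
  · linear_combination c * hxy - x * h

section realBranch

variable {α β γ δ r : ℝ} {P Q : Prop} [Decidable P] [Decidable Q]

theorem continuous_realBranch (hγ : γ ≠ 0) (hδ : δ ≠ 0) (hr : 0 < r) (hr1 : r < 1) :
    Continuous (realBranch α β γ δ r P Q) := by
  have hsc := Real.sin_sq_add_cos_sq
  have hd := deltaAmp_sq hr hr1
  have hd0 := deltaAmp_pos hr hr1
  have hcd := continuous_deltaAmp r
  have hu := fun φ => mul_sin_ne_zero_or_cos_ne_zero hr (hsc φ)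
  have hw := fun φ => num_ne_zero_or_den_ne_zero hr (hsc φ) (hd φ) (hd0 φ)
  unfold realBranch
  refine (continuous_homPoint_comp (by fun_prop) (by fun_prop) fun φ => .inr (hd0 φ).ne').prodMk
    ((continuous_homPoint_comp (by fun_prop) (by fun_prop) fun φ =>
      .inr (sub_mul_pos hr (hsc φ) (hd φ) (hd0 φ)).ne').prodMk (Continuous.prodMk ?_ ?_))
  · split_ifs
    · exact continuous_homPoint_comp (by fun_prop) (by fun_prop) fun φ => mul_ne_zero_or hγ (hu φ)
    · exact continuous_homPoint_comp (by fun_prop) (by fun_prop) fun φ =>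
        mul_ne_zero_or hγ (hu φ).symm
  · split_ifs
    · exact continuous_homPoint_comp (by fun_prop) (by fun_prop) fun φ => mul_ne_zero_or hδ (hw φ)
    · exact continuous_homPoint_comp (by fun_prop) (by fun_prop) fun φ =>
        mul_ne_zero_or hδ (hw φ).symm

/-- A reparametrized branch is nonconstant in each coordinate as soon as it attains the amplitudes
`0` and `1`. -/
theorem isNontrivialCurveOn_realBranch (hα : α ≠ 0) (hβ : β ≠ 0) (hγ : γ ≠ 0) (hδ : δ ≠ 0)
    (hr : 0 < r) (hr1 : r < 1) {f : ℝ → ℝ} {I : Set ℝ} (hf : ContinuousOn f I)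
    (h0 : 0 ∈ f '' I) (h1 : 1 ∈ f '' I) :
    IsNontrivialCurveOn (fun t => realBranch α β γ δ r P Q (f t)) I := by
  refine ⟨(continuous_realBranch hγ hδ hr hr1).comp_continuousOn hf, ?_⟩
  obtain ⟨t₀, ht₀, h0⟩ := h0
  obtain ⟨t₁, ht₁, h1⟩ := h1
  have hd10 : deltaAmp r 0 = 1 := by simp [deltaAmp]
  have hs : 0 < Real.sin 1 := Real.sin_pos_of_pos_of_lt_pi one_pos (by linarith [Real.pi_gt_three])
  have hc : 0 < Real.cos 1 := Real.cos_one_pos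
  have hsc := Real.sin_sq_add_cos_sq 1
  have hd := deltaAmp_sq hr hr1 1
  have hd0 := deltaAmp_pos hr hr1 1
  have hA := sub_mul_pos hr hsc hd hd0
  have hu := mul_sin_ne_zero_or_cos_ne_zero hr hsc
  have hw := num_ne_zero_or_den_ne_zero hr hsc hd hd0
  have hAB := sub_mul_add_eq_sq hsc hd
  have hpq := num_sq_sub_den_sq hsc hd
  have hr2 : 0 < 1 - r ^ 2 := by nlinarith
  have hr4 : 0 < 1 - r ^ 4 := by nlinarith
  have hw' : 0 < (r ^ 2 * Real.sin 1 + Real.cos 1 * deltaAmp r 1) ^ 2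
      - (Real.cos 1 - Real.sin 1 * deltaAmp r 1) ^ 2 := by rw [hpq]; positivity
  refine ⟨⟨_, ⟨t₀, ht₀, rfl⟩, _, ⟨t₁, ht₁, rfl⟩, ?_⟩, ⟨_, ⟨t₀, ht₀, rfl⟩, _, ⟨t₁, ht₁, rfl⟩, ?_⟩,
    ⟨_, ⟨t₀, ht₀, rfl⟩, _, ⟨t₁, ht₁, rfl⟩, ?_⟩, ⟨_, ⟨t₀, ht₀, rfl⟩, _, ⟨t₁, ht₁, rfl⟩, ?_⟩⟩ <;>
    simp only [realBranch, h0, h1, hd10, Real.sin_zero, Real.cos_zero]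
  · rw [Ne, homPoint_eq_homPoint_iff (.inr one_ne_zero) (.inr hd0.ne'), mul_one,
      mul_eq_left₀ (mul_ne_zero hα hr.ne')]
    intro h
    rw [h] at hd
    have : 0 < (1 - r ^ 4) * Real.sin 1 ^ 2 := by positivity
    linarith
  · rw [Ne, homPoint_eq_homPoint_iff (.inr (by norm_num)) (.inr hA.ne'), mul_assoc, mul_assoc,
      mul_right_inj' hβ]
    intro h
    have h' : deltaAmp r 1 - (1 - r ^ 2) * (Real.sin 1 * Real.cos 1)
      = Real.cos 1 ^ 2 + r ^ 2 * Real.sin 1 ^ 2 := by linarith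
    have hB := mul_left_cancel₀ hA.ne' (hAB.trans (by rw [← h']; exact sq _))
    have : 0 < (1 - r ^ 2) * (Real.sin 1 * Real.cos 1) := by positivity
    linarith
  · split_ifs
    · rw [Ne, homPoint_eq_homPoint_iff (.inr one_ne_zero) (mul_ne_zero_or hγ hu)]
      simp [hγ, hr.ne', hs.ne']
    · rw [Ne, homPoint_eq_homPoint_iff (.inl (by simpa using hγ)) (mul_ne_zero_or hγ hu.symm)]
      simp [hγ, hr.ne', hs.ne']
  · split_ifs
    · rw [Ne, homPoint_eq_homPoint_iff (.inr (by norm_num)) (mul_ne_zero_or hδ hw), mul_assoc,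
        mul_assoc, mul_right_inj' hδ]
      intro h
      have : Real.cos 1 - Real.sin 1 * deltaAmp r 1
        = r ^ 2 * Real.sin 1 + Real.cos 1 * deltaAmp r 1 := by linarith
      rw [this, sub_self] at hw'
      exact hw'.false
    · rw [Ne, homPoint_eq_homPoint_iff (.inr (by norm_num)) (mul_ne_zero_or hδ hw.symm), mul_assoc,
        mul_assoc, mul_right_inj' hδ]
      intro h
      have : Real.cos 1 - Real.sin 1 * deltaAmp r 1
        = r ^ 2 * Real.sin 1 + Real.cos 1 * deltaAmp r 1 := by linarith
      rw [this, sub_self] at hw'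
      exact hw'.false

/-- Every point of a branch solves the system whose coefficients are given by the scales.  The sign
`τ` says whether the selections in `u` and `w₂` agree. -/
theorem realBranch_mem_solutionSet (hα : α ≠ 0) (hβ : β ≠ 0) (hγ : γ ≠ 0) (hδ : δ ≠ 0)
    (hr : 0 < r) (hr1 : r < 1) {τ : ℝ} (hτ : τ = 1 ∧ (P ↔ Q) ∨ τ = -1 ∧ (P ↔ ¬ Q)) (φ : ℝ) :
    realBranch α β γ δ r P Q φ ∈ solutionSet (α ^ 2) (β ^ 2) (-γ ^ 2) (-δ ^ 2)
      (α * β * (2 * (1 + r ^ 2) / r)) (α * δ * -(2 * (1 - r ^ 2) / r))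
      (γ * δ * -(τ * (2 * (1 + r ^ 2) / r))) (γ * β * (2 * (1 - r ^ 2) / r)) := by
  have hsc := Real.sin_sq_add_cos_sq φ
  have hd := deltaAmp_sq hr hr1 φ
  have hd0 := deltaAmp_pos hr hr1 φ
  have hA := sub_mul_pos hr hsc hd hd0
  have hu := mul_sin_ne_zero_or_cos_ne_zero hr hsc
  have hw := num_ne_zero_or_den_ne_zero hr hsc hd hd0
  have hlink := fibre_link hr hsc hd
  have e1 := base_curve_eq hr hsc hd
  have e4 := fibre_u_iff hr hr1 hsc hd hd0
  have e2 := fibre_w_iff hr hr1 hsc hd hd0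
  refine ⟨?_, ?_, ?_, ?_⟩
  · rw [biquadraticEq_homPoint_mul_iff 1 1 _ hα hβ (by ring) (by ring) rfl (.inl hr.ne')
      (.inr hA.ne')]
    exact e1
  · split_ifs
    · rw [biquadraticEq_homPoint_mul_iff (-1) 1 _ hα hδ (by ring) (by ring) rfl (.inl hr.ne') hw]
      exact (e2 _ _).2 (.inl rfl)
    · rw [biquadraticEq_homPoint_mul_iff (-1) 1 _ hα hδ (by ring) (by ring) rfl (.inl hr.ne')
        hw.symm]
      exact (e2 _ _).2 (.inr rfl)
  · by_cases hP : P <;> by_cases hQ : Q <;> simp only [hP, hQ, if_true, if_false]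
    · rw [biquadraticEq_homPoint_mul_iff (-1) (-1) _ hγ hδ (by ring) (by ring) rfl hu hw]
      obtain rfl : τ = 1 := by tauto
      linear_combination hlink
    · rw [biquadraticEq_homPoint_mul_iff (-1) (-1) _ hγ hδ (by ring) (by ring) rfl hu hw.symm]
      obtain rfl : τ = -1 := by tauto
      linear_combination -hlink
    · rw [biquadraticEq_homPoint_mul_iff (-1) (-1) _ hγ hδ (by ring) (by ring) rfl hu.symm hw]
      obtain rfl : τ = -1 := by tauto
      linear_combination -hlink
    · rw [biquadraticEq_homPoint_mul_iff (-1) (-1) _ hγ hδ (by ring) (by ring) rfl hu.symm hw.symm]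
      obtain rfl : τ = 1 := by tauto
      linear_combination hlink
  · split_ifs
    · rw [biquadraticEq_homPoint_mul_iff 1 (-1) _ hγ hβ (by ring) (by ring) rfl hu (.inr hA.ne')]
      exact (e4 _ _).2 (.inl (by ring))
    · rw [biquadraticEq_homPoint_mul_iff 1 (-1) _ hγ hβ (by ring) (by ring) rfl hu.symm
        (.inr hA.ne')]
      exact (e4 _ _).2 (.inr (by ring))

/-- Conversely, each solution with `w₁ / β > 0` lies on one of the two branches with the given
scales: `(z, w₁)` determines the amplitude, each of the equations for `u` and `w₂` has two roots,
and the equation linking `u` and `w₂` leaves only the two branches. -/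
theorem exists_eq_realBranch (hα : α ≠ 0) (hβ : β ≠ 0) (hγ : γ ≠ 0) (hδ : δ ≠ 0)
    (hr : 0 < r) (hr1 : r < 1) {τ : ℝ} (hτ : τ = 1 ∨ τ = -1)
    {x : OnePoint ℝ × OnePoint ℝ × OnePoint ℝ × OnePoint ℝ}
    (hx : x ∈ solutionSet (α ^ 2) (β ^ 2) (-γ ^ 2) (-δ ^ 2)
      (α * β * (2 * (1 + r ^ 2) / r)) (α * δ * -(2 * (1 - r ^ 2) / r))
      (γ * δ * -(τ * (2 * (1 + r ^ 2) / r))) (γ * β * (2 * (1 - r ^ 2) / r)))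
    (hpos : ∀ w : ℝ, x.2.1 = (w : OnePoint ℝ) → 0 < w / β) :
    ∃ φ ∈ Ico 0 Real.pi, ∃ P : Bool, x = realBranch α β γ δ r P (P = decide (τ = 1)) φ := by
  obtain ⟨z, w₁, u, w₂⟩ := x
  obtain ⟨h1, h2, h3, h4⟩ := hx
  obtain ⟨z, z', hz, rfl⟩ := exists_eq_homPoint_mul z hα
  obtain ⟨w, w', hw, rfl⟩ := exists_eq_homPoint_mul w₁ hβ
  obtain ⟨a, a', ha, rfl⟩ := exists_eq_homPoint_mul u hγ
  obtain ⟨b, b', hb, rfl⟩ := exists_eq_homPoint_mul w₂ hδ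
  rw [biquadraticEq_homPoint_mul_iff 1 1 _ hα hβ (by ring) (by ring) rfl hz hw] at h1
  rw [biquadraticEq_homPoint_mul_iff (-1) 1 _ hα hδ (by ring) (by ring) rfl hz hb] at h2
  rw [biquadraticEq_homPoint_mul_iff (-1) (-1) _ hγ hδ (by ring) (by ring) rfl ha hb] at h3
  rw [biquadraticEq_homPoint_mul_iff 1 (-1) _ hγ hβ (by ring) (by ring) rfl ha hw] at h4
  have hsum : ∀ p q : ℝ, p ≠ 0 ∨ q ≠ 0 → p ^ 2 + 1 * q ^ 2 ≠ 0 := fun p q h h0 => by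
    have hp : p = 0 := by nlinarith [sq_nonneg p, sq_nonneg q]
    have hq : q = 0 := by nlinarith [sq_nonneg p, sq_nonneg q]
    exact h.elim (· hp) (· hq)
  have hne : z * z' ≠ 0 ∧ w * w' ≠ 0 := by
    constructor <;> intro h <;> rw [h] at h1 <;>
      exact mul_ne_zero (hsum _ _ hz) (hsum _ _ hw) (by simpa using h1)
  have hz' : z' ≠ 0 := right_ne_zero_of_mul hne.1
  have hw' : w' ≠ 0 := right_ne_zero_of_mul hne.2
  have hW : 0 < w / w' := by
    have := hpos _ (homPoint_of_ne _ hw')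
    rwa [mul_div_assoc, mul_div_cancel_left₀ _ hβ] at this
  have h1' : ((z / z') ^ 2 + 1) * ((w / w') ^ 2 + 1)
      = 2 * (1 + r ^ 2) / r * (z / z') * (w / w') := by
    field_simp
    field_simp at h1
    linear_combination h1
  have hZ : 0 < z / z' := by
    have : 0 < (z / z') * (2 * (1 + r ^ 2) / r * (w / w')) := by
      have h : 0 < ((z / z') ^ 2 + 1) * ((w / w') ^ 2 + 1) := by positivity
      rw [h1'] at h
      linarith
    exact pos_of_mul_pos_left this (by positivity)
  obtain ⟨φ, hφ, hzφ, hwφ⟩ := exists_amplitude hr hr1 hZ hW h1'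
  refine ⟨φ, hφ, ?_⟩
  have hsc := Real.sin_sq_add_cos_sq φ
  have hd := deltaAmp_sq hr hr1 φ
  have hd0 := deltaAmp_pos hr hr1 φ
  have hA := sub_mul_pos hr hsc hd hd0
  have hu := mul_sin_ne_zero_or_cos_ne_zero hr hsc
  have hwn := num_ne_zero_or_den_ne_zero hr hsc hd hd0
  have hlink := fibre_link hr hsc hd
  have e4 := fibre_u_iff hr hr1 hsc hd hd0
  have e2 := fibre_w_iff hr hr1 hsc hd hd0
  simp only [realBranch]
  generalize Real.sin φ = s at *
  generalize Real.cos φ = c at *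
  generalize deltaAmp r φ = d at *
  have hzz : z * d = r * z' := by field_simp at hzφ; linarith
  have hww : w * (d - (1 - r ^ 2) * (s * c)) = (c ^ 2 + r ^ 2 * s ^ 2) * w' := by
    field_simp at hwφ; linarith
  have hE1 : homPoint (α * z) z' = homPoint (α * r) d := by
    rw [homPoint_eq_homPoint_iff (.inr hz') (.inr hd0.ne')]
    linear_combination α * hzz
  have hE2 : homPoint (β * w) w'
      = homPoint (β * (c ^ 2 + r ^ 2 * s ^ 2)) (d - (1 - r ^ 2) * (s * c)) := by
    rw [homPoint_eq_homPoint_iff (.inr hw') (.inr hA.ne')]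
    linear_combination β * hww
  -- replace `[z : z']` by `[r : d]` and `[w : w']` by `[D : A]` in the equations for `u` and `w₂`
  have hU := (e4 a a').1 (by
    apply mul_left_cancel₀ (pow_ne_zero 2 hw')
    generalize d - (1 - r ^ 2) * (s * c) = A at *
    have hA2 := pow_ne_zero 2 hA.ne'
    generalize c ^ 2 + r ^ 2 * s ^ 2 = D at *
    have hw1 : w = D * w' / A := by rw [eq_div_iff hA.ne', hww]
    rw [hw1] at h4
    field_simp at h4 ⊢
    linear_combination h4)
  have hV := (e2 b b').1 (by
    apply mul_left_cancel₀ (pow_ne_zero 2 hz')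
    have hz1 : z = r * z' / d := by rw [eq_div_iff hd0.ne', hzz]
    rw [hz1] at h2
    field_simp at h2 ⊢
    linear_combination h2)
  rw [hE1, hE2]
  have hU1 : homPoint (γ * a) a' = homPoint (γ * (r * s)) c ↔ a * c = r * s * a' := by
    rw [homPoint_eq_homPoint_iff (mul_ne_zero_or hγ ha) (mul_ne_zero_or hγ hu), mul_assoc, mul_assoc,
      mul_right_inj' hγ]
  have hU2 : homPoint (γ * a) a' = homPoint (γ * c) (r * s) ↔ a * (r * s) = c * a' := by
    rw [homPoint_eq_homPoint_iff (mul_ne_zero_or hγ ha) (mul_ne_zero_or hγ hu.symm), mul_assoc,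
      mul_assoc, mul_right_inj' hγ]
  have hV1 : homPoint (δ * b) b' = homPoint (δ * (r ^ 2 * s + c * d)) (c - s * d)
      ↔ b * (c - s * d) = (r ^ 2 * s + c * d) * b' := by
    rw [homPoint_eq_homPoint_iff (mul_ne_zero_or hδ hb) (mul_ne_zero_or hδ hwn), mul_assoc,
      mul_assoc, mul_right_inj' hδ]
  have hV2 : homPoint (δ * b) b' = homPoint (δ * (c - s * d)) (r ^ 2 * s + c * d)
      ↔ b * (r ^ 2 * s + c * d) = (c - s * d) * b' := by
    rw [homPoint_eq_homPoint_iff (mul_ne_zero_or hδ hb) (mul_ne_zero_or hδ hwn.symm), mul_assoc,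
      mul_assoc, mul_right_inj' hδ]
  rcases hτ with rfl | rfl
  · rcases hU with hU | hU <;> rcases hV with hV | hV
    · exact ⟨true, by simp [hU1.2 hU, hV1.2 hV]⟩
    · obtain ⟨g, rfl, rfl⟩ := exists_eq_mul_of_cross_eq hu hU
      obtain ⟨l, rfl, rfl⟩ := exists_eq_mul_of_cross_eq hwn.symm hV
      rcases mul_eq_zero.1 (by linear_combination (h3 - g ^ 2 * l ^ 2 * hlink) / 2 :
        ((g * (r * s)) ^ 2 - (g * c) ^ 2) * ((l * (c - s * d)) ^ 2
          - (l * (r ^ 2 * s + c * d)) ^ 2) = 0) with h | h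
      · exact ⟨false, by simp [hU2.2 (cross_swap ha hU (sub_eq_zero.1 h)), hV2.2 hV]⟩
      · exact ⟨true, by simp [hU1.2 hU, hV1.2 (cross_swap hb hV (sub_eq_zero.1 h))]⟩
    · obtain ⟨g, rfl, rfl⟩ := exists_eq_mul_of_cross_eq hu.symm hU
      obtain ⟨l, rfl, rfl⟩ := exists_eq_mul_of_cross_eq hwn hV
      rcases mul_eq_zero.1 (by linear_combination (h3 - g ^ 2 * l ^ 2 * hlink) / 2 :
        ((g * c) ^ 2 - (g * (r * s)) ^ 2) * ((l * (r ^ 2 * s + c * d)) ^ 2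
          - (l * (c - s * d)) ^ 2) = 0) with h | h
      · exact ⟨true, by simp [hU1.2 (cross_swap ha hU (sub_eq_zero.1 h)), hV1.2 hV]⟩
      · exact ⟨false, by simp [hU2.2 hU, hV2.2 (cross_swap hb hV (sub_eq_zero.1 h))]⟩
    · exact ⟨false, by simp [hU2.2 hU, hV2.2 hV]⟩
  · have hτ : ¬ (-1 : ℝ) = 1 := by norm_num
    rcases hU with hU | hU <;> rcases hV with hV | hV
    · obtain ⟨g, rfl, rfl⟩ := exists_eq_mul_of_cross_eq hu hU
      obtain ⟨l, rfl, rfl⟩ := exists_eq_mul_of_cross_eq hwn hV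
      rcases mul_eq_zero.1 (by linear_combination (h3 + g ^ 2 * l ^ 2 * hlink) / 2 :
        ((g * (r * s)) ^ 2 - (g * c) ^ 2) * ((l * (r ^ 2 * s + c * d)) ^ 2
          - (l * (c - s * d)) ^ 2) = 0) with h | h
      · exact ⟨false, by simp [hτ, hU2.2 (cross_swap ha hU (sub_eq_zero.1 h)), hV1.2 hV]⟩
      · exact ⟨true, by simp [hτ, hU1.2 hU, hV2.2 (cross_swap hb hV (sub_eq_zero.1 h))]⟩
    · exact ⟨true, by simp [hτ, hU1.2 hU, hV2.2 hV]⟩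
    · exact ⟨false, by simp [hτ, hU2.2 hU, hV1.2 hV]⟩
    · obtain ⟨g, rfl, rfl⟩ := exists_eq_mul_of_cross_eq hu.symm hU
      obtain ⟨l, rfl, rfl⟩ := exists_eq_mul_of_cross_eq hwn.symm hV
      rcases mul_eq_zero.1 (by linear_combination (h3 + g ^ 2 * l ^ 2 * hlink) / 2 :
        ((g * c) ^ 2 - (g * (r * s)) ^ 2) * ((l * (c - s * d)) ^ 2
          - (l * (r ^ 2 * s + c * d)) ^ 2) = 0) with h | h
      · exact ⟨true, by simp [hτ, hU1.2 (cross_swap ha hU (sub_eq_zero.1 h)), hV2.2 hV]⟩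
      · exact ⟨false, by simp [hτ, hU2.2 hU, hV1.2 (cross_swap hb hV (sub_eq_zero.1 h))]⟩

/-- A solution on a branch determines the common sign of the scales, the amplitude and the selection:
the sign is read off from `w₁`, the amplitude from `(z, w₁)`, and the selection from `(u, w₂)`. -/
theorem realBranch_injective (hβ : β ≠ 0) (hγ : γ ≠ 0) (hδ : δ ≠ 0)
    (hr : 0 < r) (hr1 : r < 1) {α' β' γ' δ' : ℝ}
    (hα0 : α ≠ 0) (hββ' : β' = β ∧ α' = α ∧ γ' = γ ∧ δ' = δ ∨ β' = -β)
    {P' Q' : Prop} [Decidable P'] [Decidable Q'] (hPQ : (P ↔ Q) ↔ (P' ↔ Q'))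
    {φ φ' : ℝ} (hφ : φ ∈ Ico 0 Real.pi) (hφ' : φ' ∈ Ico 0 Real.pi)
    (h : realBranch α β γ δ r P Q φ = realBranch α' β' γ' δ' r P' Q' φ') :
    β' = β ∧ (P ↔ P') ∧ φ = φ' := by
  have hsc := Real.sin_sq_add_cos_sq φ
  have hd := deltaAmp_sq hr hr1 φ
  have hd0 := deltaAmp_pos hr hr1 φ
  have hA := sub_mul_pos hr hsc hd hd0
  have hD := sq_add_mul_sq_pos hr hsc
  have hsc' := Real.sin_sq_add_cos_sq φ'
  have hd' := deltaAmp_sq hr hr1 φ'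
  have hd0' := deltaAmp_pos hr hr1 φ'
  have hA' := sub_mul_pos hr hsc' hd' hd0'
  have hD' := sq_add_mul_sq_pos hr hsc'
  simp only [realBranch, Prod.mk.injEq] at h
  obtain ⟨h1, h2, h3, h4⟩ := h
  rw [homPoint_eq_homPoint_iff (.inr hd0.ne') (.inr hd0'.ne')] at h1
  rw [homPoint_eq_homPoint_iff (.inr hA.ne') (.inr hA'.ne')] at h2
  obtain ⟨rfl, rfl, rfl, rfl⟩ | rfl := hββ'
  swap
  · exfalso
    have h : β * ((Real.cos φ ^ 2 + r ^ 2 * Real.sin φ ^ 2)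
        * (deltaAmp r φ' - (1 - r ^ 2) * (Real.sin φ' * Real.cos φ'))
        + (Real.cos φ' ^ 2 + r ^ 2 * Real.sin φ' ^ 2)
        * (deltaAmp r φ - (1 - r ^ 2) * (Real.sin φ * Real.cos φ))) = 0 := by
      linear_combination h2
    exact mul_ne_zero hβ (by positivity) h
  have hr2 : 0 < 1 - r ^ 2 := by nlinarith
  have hr4 : 0 < 1 - r ^ 4 := by nlinarith
  have hdd : deltaAmp r φ' = deltaAmp r φ :=
    mul_left_cancel₀ (mul_ne_zero hα0 hr.ne') h1
  have hss : Real.sin φ ^ 2 = Real.sin φ' ^ 2 := by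
    rw [hdd, hd, sub_right_inj] at hd'
    exact mul_left_cancel₀ hr4.ne' hd'
  have hcc : Real.cos φ ^ 2 = Real.cos φ' ^ 2 := by rw [Real.cos_sq', Real.cos_sq', hss]
  rw [← hss, ← hcc, mul_assoc, mul_assoc, mul_right_inj' hβ, mul_right_inj' hD.ne', hdd,
    sub_right_inj, mul_right_inj' hr2.ne'] at h2
  obtain rfl := amplitude_injective hφ hφ' hss h2.symm
  refine ⟨rfl, ?_, rfl⟩
  by_contra hPP
  have hu := mul_sin_ne_zero_or_cos_ne_zero hr hsc
  have hw := num_ne_zero_or_den_ne_zero hr hsc hd hd0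
  refine fibre_ne hr hsc hd hd0 ?_ ?_
  · have h : homPoint (γ' * (r * Real.sin φ)) (Real.cos φ)
        = homPoint (γ' * Real.cos φ) (r * Real.sin φ) := by
      by_cases hP : P
      · rwa [if_pos hP, if_neg (by tauto)] at h3
      · rw [if_neg hP, if_pos (by tauto)] at h3
        exact h3.symm
    rw [homPoint_eq_homPoint_iff (mul_ne_zero_or hγ hu) (mul_ne_zero_or hγ hu.symm)] at h
    apply mul_left_cancel₀ hγ
    linear_combination h
  · have h : homPoint (δ' * (r ^ 2 * Real.sin φ + Real.cos φ * deltaAmp r φ))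
          (Real.cos φ - Real.sin φ * deltaAmp r φ)
        = homPoint (δ' * (Real.cos φ - Real.sin φ * deltaAmp r φ))
          (r ^ 2 * Real.sin φ + Real.cos φ * deltaAmp r φ) := by
      by_cases hQ : Q
      · rwa [if_pos hQ, if_neg (by tauto)] at h4
      · rw [if_neg hQ, if_pos (by tauto)] at h4
        exact h4.symm
    rw [homPoint_eq_homPoint_iff (mul_ne_zero_or hδ hw) (mul_ne_zero_or hδ hw.symm)] at h
    apply mul_left_cancel₀ hδ
    linear_combination h
end realBranch

/-! ### Shifts by `K / 2` and by `K` -/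

theorem compModulus_sq {k : ℝ} (hk : k ^ 2 < 1) : compModulus k ^ 2 = 1 - k ^ 2 :=
  Real.sq_sqrt (by linarith)

theorem sq_lt_one_of_eq_one_sub {κ r : ℝ} (hr : 0 < r) (hκ : κ ^ 2 = 1 - r ^ 4) : κ ^ 2 < 1 := by
  have : 0 < r ^ 4 := by positivity
  linarith

/-- The values at `K / 2` for a modulus `κ` whose complementary modulus is `r²`. They follow from
`cn K = 0` and the addition theorem. -/
theorem ellipticK_half {κ r : ℝ} (hr : 0 < r) (hκ : κ ^ 2 = 1 - r ^ 4) :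
    0 < realSn κ (ellipticK κ / 2) ∧
    realSn κ (ellipticK κ / 2) ^ 2 * (1 + r ^ 2) = 1 ∧
    realCn κ (ellipticK κ / 2) = r * realSn κ (ellipticK κ / 2) ∧
    realDn κ (ellipticK κ / 2) = r := by
  have hk := sq_lt_one_of_eq_one_sub hr hκ
  have hK := ellipticK_pos hk
  have h0 : 0 < jacobiAm κ (ellipticK κ / 2) := by
    rw [← jacobiAm_zero hk]
    exact strictMono_jacobiAm hk (by linarith)
  have h1 : jacobiAm κ (ellipticK κ / 2) < Real.pi / 2 := by
    rw [← jacobiAm_ellipticK hk]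
    exact strictMono_jacobiAm hk (by linarith)
  have hS : 0 < realSn κ (ellipticK κ / 2) :=
    Real.sin_pos_of_pos_of_lt_pi h0 (by linarith [Real.pi_pos])
  have hC : 0 < realCn κ (ellipticK κ / 2) :=
    Real.cos_pos_of_mem_Ioo ⟨by linarith [Real.pi_pos], h1⟩
  have hD := realDn_pos hk (ellipticK κ / 2)
  have hsc := realSn_sq_add_realCn_sq κ (ellipticK κ / 2)
  have hd := realDn_sq hk (ellipticK κ / 2)
  have hadd := realCn_add hk (ellipticK κ / 2) (ellipticK κ / 2)
  have hden := addition_denominator_pos hk (ellipticK κ / 2) (ellipticK κ / 2)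
  rw [add_halves, realCn_ellipticK hk, eq_comm, div_eq_zero_iff, or_iff_left hden.ne'] at hadd
  rw [hκ] at hd
  generalize realSn κ (ellipticK κ / 2) = S at *
  generalize realCn κ (ellipticK κ / 2) = C at *
  generalize realDn κ (ellipticK κ / 2) = d at *
  have hCd : C = S * d := by
    rw [← sq_eq_sq₀ hC.le (by positivity)]
    linear_combination hadd
  have hS2 : S ^ 2 * (1 + r ^ 2) = 1 := by
    have h : (S ^ 2 * (1 + r ^ 2) - 1) * (S ^ 2 * (1 - r ^ 2) - 1) = 0 := by
      rw [hCd] at hsc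
      linear_combination S ^ 2 * hd - hsc
    rcases mul_eq_zero.1 h with h | h
    · linarith
    · -- the other root `S² = 1 / (1 - r²)` exceeds `1`
      have hS1 : S ^ 2 < 1 := by nlinarith
      nlinarith [mul_pos (pow_pos hS 2) (pow_pos hr 2)]
  have hdr : d = r := by
    rw [← sq_eq_sq₀ hD.le hr.le]
    linear_combination hd - (1 - r ^ 2) * hS2
  exact ⟨hS, hS2, by rw [hCd, hdr, mul_comm], hdr⟩

section

variable {κ r : ℝ}

/-- The denominator of the addition theorem for a shift by `K / 2`. -/
theorem half_denominator (hr : 0 < r) (hκ : κ ^ 2 = 1 - r ^ 4) (x : ℝ) :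
    1 - κ ^ 2 * realSn κ x ^ 2 * realSn κ (ellipticK κ / 2) ^ 2
      = realCn κ x ^ 2 + r ^ 2 * realSn κ x ^ 2 := by
  obtain ⟨-, hS2, -, -⟩ := ellipticK_half hr hκ
  rw [hκ]
  linear_combination (-(1 - r ^ 2) * realSn κ x ^ 2) * hS2 - realSn_sq_add_realCn_sq κ x

theorem realDn_add_half (hr : 0 < r) (hκ : κ ^ 2 = 1 - r ^ 4) (x : ℝ) :
    realDn κ (x + ellipticK κ / 2) = r * (realDn κ x - (1 - r ^ 2) * (realSn κ x * realCn κ x))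
      / (realCn κ x ^ 2 + r ^ 2 * realSn κ x ^ 2) := by
  have hk := sq_lt_one_of_eq_one_sub hr hκ
  obtain ⟨-, hS2, hC, hd⟩ := ellipticK_half hr hκ
  rw [realDn_add hk, half_denominator hr hκ, hC, hd, hκ]
  congr 1
  linear_combination (-(1 - r ^ 2) * r * realSn κ x * realCn κ x) * hS2

theorem realSn_realCn_add_half (hr : 0 < r) (hκ : κ ^ 2 = 1 - r ^ 4) (x : ℝ) : ∃ g : ℝ, g ≠ 0 ∧
    realSn κ (x + ellipticK κ / 2) = (r ^ 2 * realSn κ x + realCn κ x * realDn κ x) * g ∧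
    realCn κ (x + ellipticK κ / 2) = (realCn κ x - realSn κ x * realDn κ x) * (r * g) := by
  have hk := sq_lt_one_of_eq_one_sub hr hκ
  obtain ⟨hS, -, hC, hd⟩ := ellipticK_half hr hκ
  have hD := sq_add_mul_sq_pos hr (realSn_sq_add_realCn_sq κ x)
  refine ⟨realSn κ (ellipticK κ / 2) / (realCn κ x ^ 2 + r ^ 2 * realSn κ x ^ 2),
    (div_pos hS hD).ne', ?_, ?_⟩
  · rw [realSn_add hk, half_denominator hr hκ, hC, hd]
    ring
  · rw [realCn_add hk, half_denominator hr hκ, hC, hd]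
    ring

theorem realSn_realCn_sub_half (hr : 0 < r) (hκ : κ ^ 2 = 1 - r ^ 4) (x : ℝ) : ∃ g : ℝ, g ≠ 0 ∧
    realSn κ (x - ellipticK κ / 2) = (r ^ 2 * realSn κ x - realCn κ x * realDn κ x) * g ∧
    realCn κ (x - ellipticK κ / 2) = (realCn κ x + realSn κ x * realDn κ x) * (r * g) := by
  have hk := sq_lt_one_of_eq_one_sub hr hκ
  obtain ⟨hS, -, hC, hd⟩ := ellipticK_half hr hκ
  have hD := sq_add_mul_sq_pos hr (realSn_sq_add_realCn_sq κ x)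
  refine ⟨realSn κ (ellipticK κ / 2) / (realCn κ x ^ 2 + r ^ 2 * realSn κ x ^ 2),
    (div_pos hS hD).ne', ?_, ?_⟩
  · rw [sub_eq_add_neg, realSn_add hk, realSn_neg hk, realCn_neg hk, realDn_neg hk, neg_sq,
      half_denominator hr hκ, hC, hd]
    ring
  · rw [sub_eq_add_neg, realCn_add hk, realSn_neg hk, realCn_neg hk, realDn_neg hk, neg_sq,
      half_denominator hr hκ, hC, hd]
    ring

theorem realSn_realCn_add_ellipticK (hr : 0 < r) (hκ : κ ^ 2 = 1 - r ^ 4) (x : ℝ) :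
    ∃ g : ℝ, g ≠ 0 ∧ realSn κ (x + ellipticK κ) = realCn κ x * g ∧
      realCn κ (x + ellipticK κ) = -(r ^ 2 * realSn κ x) * g := by
  have hk := sq_lt_one_of_eq_one_sub hr hκ
  have hd := realDn_pos hk x
  have hK : realDn κ (ellipticK κ) = r ^ 2 := by
    rw [realDn, realSn_ellipticK hk, hκ,
      show 1 - (1 - r ^ 4) * 1 ^ 2 = (r ^ 2) ^ 2 by ring, Real.sqrt_sq (by positivity)]
  refine ⟨(realDn κ x)⁻¹, inv_ne_zero hd.ne', ?_, ?_⟩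
  · rw [realSn_add hk, realSn_ellipticK hk, realCn_ellipticK hk, one_pow, mul_one, ← realDn_sq hk]
    field_simp
    ring
  · rw [realCn_add hk, realSn_ellipticK hk, realCn_ellipticK hk, hK, one_pow,
      mul_one (κ ^ 2 * realSn κ x ^ 2), ← realDn_sq hk]
    field_simp
    ring

theorem realDn_eq_deltaAmp (hκ : κ ^ 2 = 1 - r ^ 4) (x : ℝ) :
    realDn κ x = deltaAmp r (jacobiAm κ x) := by
  rw [realDn, deltaAmp, hκ, realSn]

end

/-! ### `jacobiSn` on the vertical lines through `0`, `K` and `2K` -/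

section

variable {k : ℝ}

theorem sphereMul_jacobiSn_of_re_eq_zero (hk : k ^ 2 < 1) {v : ℂ} (hv : v.re = 0) (a : ℝ) :
    sphereMul (Complex.I * a) (jacobiSn k v) = toSphere (homPoint
      (a * -realSn (compModulus k) v.im) (realCn (compModulus k) v.im)) := by
  rw [toSphere_homPoint]
  simp only [jacobiSn, hv, realSn_zero hk, realCn_zero hk, realDn_zero hk]
  by_cases h : realCn (compModulus k) v.im = 0
  · simp [h, sphereMul]
  · have h' : (realCn (compModulus k) v.im : ℂ) ≠ 0 := by exact_mod_cast h
    simp only [h, sphereMul, if_false]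
    rw [if_neg (by simpa using h), OnePoint.map_some, OnePoint.coe_eq_coe]
    push_cast
    field_simp
    linear_combination
      (a * realSn (compModulus k) v.im * realCn (compModulus k) v.im ^ 2 : ℂ) * Complex.I_sq

theorem sphereMul_jacobiSn_of_re_eq_two_mul_ellipticK (hk : k ^ 2 < 1) {v : ℂ}
    (hv : v.re = 2 * ellipticK k) (a : ℝ) :
    sphereMul (Complex.I * a) (jacobiSn k v) = toSphere (homPoint
      (a * realSn (compModulus k) v.im) (realCn (compModulus k) v.im)) := by
  have hd : realDn k (2 * ellipticK k) = 1 := by simp [realDn, realSn_two_mul_ellipticK hk]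
  rw [toSphere_homPoint]
  simp only [jacobiSn, hv, realSn_two_mul_ellipticK hk, realCn_two_mul_ellipticK hk, hd]
  by_cases h : realCn (compModulus k) v.im = 0
  · simp [h, sphereMul]
  · have h' : (realCn (compModulus k) v.im : ℂ) ≠ 0 := by exact_mod_cast h
    simp only [h, sphereMul, if_false]
    rw [if_neg (by simpa using h), OnePoint.map_some, OnePoint.coe_eq_coe]
    push_cast
    field_simp
    linear_combination
      -(a * realSn (compModulus k) v.im * realCn (compModulus k) v.im ^ 2 : ℂ) * Complex.I_sq

theorem sphereMul_jacobiSn_of_re_eq_ellipticK (hk0 : k ≠ 0) (hk : k ^ 2 < 1) {v : ℂ}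
    (hv : v.re = ellipticK k) (a : ℝ) :
    sphereMul a (jacobiSn k v) = toSphere (homPoint a (realDn (compModulus k) v.im)) := by
  have hk' : compModulus k ^ 2 < 1 := by
    rw [compModulus_sq hk]
    have : 0 < k ^ 2 := by positivity
    linarith
  have hd := realDn_pos hk' v.im
  have hd' : (realDn (compModulus k) v.im : ℂ) ≠ 0 := by exact_mod_cast hd.ne'
  have hD : realCn (compModulus k) v.im ^ 2 + k ^ 2 * 1 ^ 2 * realSn (compModulus k) v.im ^ 2
      = realDn (compModulus k) v.im ^ 2 := by
    rw [realDn_sq hk', compModulus_sq hk]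
    linear_combination realSn_sq_add_realCn_sq (compModulus k) v.im
  rw [toSphere_homPoint, if_neg hd.ne']
  simp only [jacobiSn, hv, realSn_ellipticK hk, realCn_ellipticK hk, hD, sphereMul]
  rw [if_neg (pow_ne_zero 2 hd.ne'), OnePoint.map_some, OnePoint.coe_eq_coe]
  push_cast
  field_simp
  ring

end

/-! ### The four branches -/

theorem realBranch_congr {α β γ δ r : ℝ} {P Q P' Q' : Prop} [Decidable P] [Decidable Q]
    [Decidable P'] [Decidable Q'] (hP : P ↔ P') (hQ : Q ↔ Q') (φ : ℝ) :
    realBranch α β γ δ r P Q φ = realBranch α β γ δ r P' Q' φ := by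
  simp only [realBranch, hP, hQ]

theorem mul_sign_of_sign {p q : ℝ} (hp : p = -1 ∨ p = 1) (hq : q = -1 ∨ q = 1) :
    p * q = -1 ∨ p * q = 1 := by
  rcases hp with rfl | rfl <;> rcases hq with rfl | rfl <;> norm_num

theorem sq_eq_one_of_sign {p : ℝ} (hp : p = -1 ∨ p = 1) : p ^ 2 = 1 := by
  rcases hp with rfl | rfl <;> norm_num

theorem ne_zero_of_sign {p : ℝ} (hp : p = -1 ∨ p = 1) : p ≠ 0 := by
  rcases hp with rfl | rfl <;> norm_num

theorem sign_eq_of_mul_eq_one_iff {p σ σ' : ℝ} (hp : p = -1 ∨ p = 1) (hσ : σ = -1 ∨ σ = 1)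
    (hσ' : σ' = -1 ∨ σ' = 1) (h : σ * p = 1 ↔ σ' * p = 1) : σ = σ' := by
  rcases hp with rfl | rfl <;> rcases hσ with rfl | rfl <;> rcases hσ' with rfl | rfl <;>
    first | rfl | norm_num at h

theorem sign_selection_iff {p q σ σ' : ℝ} (hp : p = -1 ∨ p = 1) (hq : q = -1 ∨ q = 1)
    (hσ : σ = -1 ∨ σ = 1) (hσ' : σ' = -1 ∨ σ' = 1) :
    (σ * p = 1 ↔ σ * q = 1) ↔ (σ' * p = 1 ↔ σ' * q = 1) := by
  rcases hp with rfl | rfl <;> rcases hq with rfl | rfl <;> rcases hσ with rfl | rfl <;>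
    rcases hσ' with rfl | rfl <;> norm_num

/-- For signs `p`, `q`, `σ`: the conditions `σ p = 1` and `σ q = 1` agree exactly when `p q = 1`. -/
theorem sign_selection {p q σ : ℝ} (hp : p = -1 ∨ p = 1) (hq : q = -1 ∨ q = 1)
    (hσ : σ = -1 ∨ σ = 1) :
    p * q = 1 ∧ (σ * p = 1 ↔ σ * q = 1) ∨ p * q = -1 ∧ (σ * p = 1 ↔ ¬ σ * q = 1) := by
  rcases hp with rfl | rfl <;> rcases hq with rfl | rfl <;> rcases hσ with rfl | rfl <;> norm_num

/-- The signs of the coefficients are absorbed into the scales of the unknowns; the product of all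
four is what remains in the third equation. -/
theorem solutionSet_eq_of_signs {a b c e : ℝ} (m n : ℝ) {s₁ s₂ s₃ s₄ ε : ℝ}
    (hs₁ : s₁ = -1 ∨ s₁ = 1) (hs₂ : s₂ = -1 ∨ s₂ = 1) (hs₄ : s₄ = -1 ∨ s₄ = 1)
    (hε : ε = -1 ∨ ε = 1) :
    solutionSet (a ^ 2) (b ^ 2) (-c ^ 2) (-e ^ 2) (s₁ * (a * b * m)) (s₂ * (a * e * n))
        (s₃ * (c * e * m)) (s₄ * (c * b * n)) =
      solutionSet ((ε * (s₁ * a)) ^ 2) ((ε * b) ^ 2) (-(ε * (s₄ * c)) ^ 2)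
        (-(ε * (-(s₁ * s₂) * e)) ^ 2) (ε * (s₁ * a) * (ε * b) * m)
        (ε * (s₁ * a) * (ε * (-(s₁ * s₂) * e)) * -n)
        (ε * (s₄ * c) * (ε * (-(s₁ * s₂) * e)) * -(s₁ * s₂ * (s₃ * s₄) * m))
        (ε * (s₄ * c) * (ε * b) * n) := by
  have h0 := sq_eq_one_of_sign hε
  have h1 := sq_eq_one_of_sign hs₁
  have h2 := sq_eq_one_of_sign hs₂
  have h4 := sq_eq_one_of_sign hs₄
  congr 1
  · linear_combination (-a ^ 2 * s₁ ^ 2) * h0 - a ^ 2 * h1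
  · linear_combination (-b ^ 2) * h0
  · linear_combination (c ^ 2 * s₄ ^ 2) * h0 + c ^ 2 * h4
  · linear_combination (e ^ 2 * s₁ ^ 2 * s₂ ^ 2) * h0 + e ^ 2 * s₂ ^ 2 * h1 + e ^ 2 * h2
  · linear_combination (-s₁ * (a * b * m)) * h0
  · linear_combination (-s₂ * (a * e * n)) * (s₁ ^ 2 * h0 + h1)
  · linear_combination (-s₃ * (c * e * m)) *
      (s₁ ^ 2 * s₂ ^ 2 * s₄ ^ 2 * h0 + s₂ ^ 2 * s₄ ^ 2 * h1 + s₄ ^ 2 * h2 + h4)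
  · linear_combination (-s₄ * (c * b * n)) * h0

/-- The four branches of solutions, parametrized by the amplitude. -/
theorem bijOn_realBranch {a b c e r s₁ s₂ s₃ s₄ : ℝ} (ha : 0 < a) (hb : 0 < b) (hc : 0 < c)
    (he : 0 < e) (hr : 0 < r) (hr1 : r < 1) (hs₁ : s₁ = -1 ∨ s₁ = 1) (hs₂ : s₂ = -1 ∨ s₂ = 1)
    (hs₃ : s₃ = -1 ∨ s₃ = 1) (hs₄ : s₄ = -1 ∨ s₄ = 1) :
    BijOn (fun q : ℝ × ℝ × ℝ => realBranch (q.1 * (s₁ * a)) (q.1 * b) (q.1 * (s₄ * c))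
        (q.1 * (-(s₁ * s₂) * e)) r (q.2.1 * (s₁ * s₂) = 1) (q.2.1 * (s₃ * s₄) = 1) q.2.2)
      (({1, -1} : Set ℝ) ×ˢ ({1, -1} : Set ℝ) ×ˢ Ico 0 Real.pi)
      (solutionSet (a ^ 2) (b ^ 2) (-c ^ 2) (-e ^ 2) (s₁ * (a * b * (2 * (1 + r ^ 2) / r)))
        (s₂ * (a * e * (2 * (1 - r ^ 2) / r))) (s₃ * (c * e * (2 * (1 + r ^ 2) / r)))
        (s₄ * (c * b * (2 * (1 - r ^ 2) / r)))) := by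
  have hS := fun {ε : ℝ} => solutionSet_eq_of_signs (a := a) (b := b) (c := c) (e := e)
    (s₃ := s₃) (ε := ε) (2 * (1 + r ^ 2) / r) (2 * (1 - r ^ 2) / r) hs₁ hs₂ hs₄
  have h12 := mul_sign_of_sign hs₁ hs₂
  have h34 := mul_sign_of_sign hs₃ hs₄
  have hτ := fun {σ : ℝ} => sign_selection (σ := σ) h12 h34
  have hmem : ∀ {x : ℝ}, x ∈ ({1, -1} : Set ℝ) ↔ x = -1 ∨ x = 1 := by
    intro x
    simp [or_comm]
  have hα : ∀ {ε : ℝ}, ε = -1 ∨ ε = 1 → ε * (s₁ * a) ≠ 0 := fun h =>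
    mul_ne_zero (ne_zero_of_sign h) (mul_ne_zero (ne_zero_of_sign hs₁) ha.ne')
  have hβ : ∀ {ε : ℝ}, ε = -1 ∨ ε = 1 → ε * b ≠ 0 := fun h =>
    mul_ne_zero (ne_zero_of_sign h) hb.ne'
  have hγ : ∀ {ε : ℝ}, ε = -1 ∨ ε = 1 → ε * (s₄ * c) ≠ 0 := fun h =>
    mul_ne_zero (ne_zero_of_sign h) (mul_ne_zero (ne_zero_of_sign hs₄) hc.ne')
  have hδ : ∀ {ε : ℝ}, ε = -1 ∨ ε = 1 → ε * (-(s₁ * s₂) * e) ≠ 0 := fun h =>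
    mul_ne_zero (ne_zero_of_sign h) (mul_ne_zero (neg_ne_zero.2
      (mul_ne_zero (ne_zero_of_sign hs₁) (ne_zero_of_sign hs₂))) he.ne')
  refine ⟨?_, ?_, ?_⟩
  · rintro ⟨ε, σ, φ⟩ ⟨hε, hσ, -⟩
    rw [hmem] at hε hσ
    rw [hS hε]
    exact realBranch_mem_solutionSet (hα hε) (hβ hε) (hγ hε) (hδ hε) hr hr1 (hτ hσ) φ
  · rintro ⟨ε, σ, φ⟩ ⟨hε, hσ, hφ⟩ ⟨ε', σ', φ'⟩ ⟨hε', hσ', hφ'⟩ h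
    rw [hmem] at hε hσ hε' hσ'
    dsimp only at hε hσ hφ hε' hσ' hφ' h
    have hεε' : ε' = ε ∨ ε' = -ε := by
      rcases hε with h | h <;> rcases hε' with h' | h' <;> rw [h, h'] <;> norm_num
    obtain ⟨h1, h2, h3⟩ := realBranch_injective (hβ hε) (hγ hε) (hδ hε) hr hr1 (hα hε)
      (hεε'.imp (fun h => by simp [h]) (fun h => by simp [h]))
      (sign_selection_iff h12 h34 hσ hσ') hφ hφ' h
    obtain rfl := mul_right_cancel₀ hb.ne' h1
    rw [h3, sign_eq_of_mul_eq_one_iff h12 hσ hσ' h2]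
  · intro x hx
    -- `ε` is the sign of `w₁`, which is finite and nonzero in every solution
    obtain ⟨ε, hε, hpos⟩ : ∃ ε : ℝ, (ε = -1 ∨ ε = 1) ∧
        ∀ w : ℝ, x.2.1 = (w : OnePoint ℝ) → 0 < w / (ε * b) := by
      obtain ⟨z, w, u, v⟩ := x
      induction w using OnePoint.rec with
      | infty =>
        -- here the positivity condition is vacuous
        exact ⟨1, .inr rfl, fun w hw => absurd hw (OnePoint.infty_ne_coe w)⟩
      | coe w =>
        have hw : w ≠ 0 := by
          rintro rfl
          have h1 := hx.1
          obtain ⟨z, z', hz, rfl⟩ := exists_eq_homPoint_mul z one_ne_zero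
          rw [show ((0 : ℝ) : OnePoint ℝ) = homPoint (1 * 0) 1 by simp [homPoint],
            biquadraticEq_homPoint_iff _ _ _ (mul_ne_zero_or one_ne_zero hz) (.inr one_ne_zero)]
            at h1
          have h2 : (z ^ 2 + a ^ 2 * z' ^ 2) * b ^ 2 = 0 := by linear_combination h1
          have h3 : 0 < z ^ 2 + a ^ 2 * z' ^ 2 := by
            rcases hz with h | h <;> positivity
          exact (mul_pos h3 (pow_pos hb 2)).ne' h2
        rcases lt_or_gt_of_ne hw with hw | hw
        · refine ⟨-1, .inl rfl, fun w' hw' => ?_⟩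
          obtain rfl := OnePoint.coe_injective hw'
          exact div_pos_of_neg_of_neg hw (by linarith)
        · refine ⟨1, .inr rfl, fun w' hw' => ?_⟩
          obtain rfl := OnePoint.coe_injective hw'
          exact div_pos hw (by linarith)
    rw [hS hε] at hx
    have hτ' : s₁ * s₂ * (s₃ * s₄) = 1 ∨ s₁ * s₂ * (s₃ * s₄) = -1 :=
      (hτ (.inr rfl)).imp And.left And.left
    obtain ⟨φ, hφ, P, rfl⟩ := exists_eq_realBranch (hα hε) (hβ hε) (hγ hε) (hδ hε) hr hr1 hτ' hx hpos
    obtain ⟨σ, hσ, hP⟩ : ∃ σ : ℝ, (σ = -1 ∨ σ = 1) ∧ (σ * (s₁ * s₂) = 1 ↔ P = true) := by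
      have h12' : s₁ * s₂ * (s₁ * s₂) = 1 := by rw [← sq, sq_eq_one_of_sign h12]
      cases P
      · exact ⟨-(s₁ * s₂), by rcases h12 with h | h <;> rw [h] <;> norm_num,
          by rw [neg_mul, h12']; norm_num⟩
      · exact ⟨s₁ * s₂, h12, by rw [h12']; norm_num⟩
    refine ⟨(ε, σ, φ), ⟨hmem.2 hε, hmem.2 hσ, hφ⟩, realBranch_congr hP ?_ φ⟩
    have hneg : ¬ (-1 : ℝ) = 1 := by norm_num
    dsimp only at hP ⊢
    rcases hτ hσ with ⟨h, h'⟩ | ⟨h, h'⟩ <;> rw [h]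
    · rw [← h', hP]
      simp
    · rw [hP] at h'
      cases P <;> simp [hneg] at h' ⊢ <;> exact h'

/-! ### Comparison of the elliptic branches with the real ones -/

/-- On the vertical lines met by a branch the Jacobi elliptic sine is expressed by the elliptic
functions of `t` with the complementary modulus; the shifts of `t` by `K'` and `±K' / 2` turn the
branch into its real form at the amplitude `am(t, k')`. -/
theorem ellipticBranch_eq {lam₁ mu₁ lam₃ mu₃ nu₁ nu₂ nu₃ nu₄ k a b c e r σ : ℝ}
    (ha : 0 < a) (hb : 0 < b) (hc : 0 < c) (he : 0 < e) (hr : 0 < r) (hr1 : r < 1)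
    (hlam₁ : lam₁ = a ^ 2) (hmu₁ : mu₁ = b ^ 2) (hlam₃ : lam₃ = -c ^ 2) (hmu₃ : mu₃ = -e ^ 2)
    (hk : k = r ^ 2) (h12 : nu₁ * nu₂ ≠ 0) (h34 : nu₃ * nu₄ ≠ 0) (hσ : σ = -1 ∨ σ = 1) (t : ℝ) :
    ellipticBranch lam₁ mu₁ lam₃ mu₃ nu₁ nu₂ nu₃ nu₄ k σ t = toSphere4
      (realBranch (Real.sign nu₁ * a) b (Real.sign nu₄ * c) (-(Real.sign (nu₁ * nu₂)) * e) r
        (σ * Real.sign (nu₁ * nu₂) = 1) (σ * Real.sign (nu₃ * nu₄) = 1)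
        (jacobiAm (compModulus k) t)) := by
  have hk0 : k ≠ 0 := by rw [hk]; positivity
  have hk1 : k ^ 2 < 1 := by
    rw [hk, ← pow_mul]
    exact pow_lt_one₀ hr.le hr1 (by norm_num)
  have hκ : compModulus k ^ 2 = 1 - r ^ 4 := by rw [compModulus_sq hk1, hk]; ring
  have hκ1 := sq_lt_one_of_eq_one_sub hr hκ
  have hsqrt : ∀ {x y : ℝ}, 0 < y → x = y ^ 2 → √(x * k) = y * r := fun hy hx => by
    rw [hx, hk, ← mul_pow, Real.sqrt_sq (by positivity)]
  have hsc := realSn_sq_add_realCn_sq (compModulus k) t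
  have hd : realDn (compModulus k) t ^ 2 = 1 - (1 - r ^ 4) * realSn (compModulus k) t ^ 2 := by
    rw [realDn_sq hκ1, hκ]
  have hd0 := realDn_pos hκ1 t
  have hD := sq_add_mul_sq_pos hr hsc
  have hsign : ∀ {x : ℝ}, x ≠ 0 → σ * Real.sign x = -1 ∨ σ * Real.sign x = 1 := fun hx => by
    rcases hσ with rfl | rfl <;> rcases Real.sign_apply_eq_of_ne_zero _ hx with h | h <;>
      rw [h] <;> norm_num
  have hn : ¬ (-1 : ℝ) = 1 := by norm_num
  have hs : Real.sin (jacobiAm (compModulus k) t) = realSn (compModulus k) t := rfl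
  have hc' : Real.cos (jacobiAm (compModulus k) t) = realCn (compModulus k) t := rfl
  simp only [ellipticBranch, realBranch, toSphere4, Prod.mk.injEq, hs, hc', ← realDn_eq_deltaAmp hκ]
  refine ⟨?_, ?_, ?_, ?_⟩
  · rw [hsqrt ha hlam₁, ← Complex.ofReal_mul,
      sphereMul_jacobiSn_of_re_eq_ellipticK hk0 hk1 (by simp)]
    simp [mul_assoc]
  · rw [hsqrt hb hmu₁, sphereMul_jacobiSn_of_re_eq_ellipticK hk0 hk1 (by simp)]
    have him : ((ellipticK k : ℂ) + Complex.I * (ellipticK (compModulus k) : ℂ) / 2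
        + Complex.I * (t : ℂ)).im = t + ellipticK (compModulus k) / 2 := by
      simp [add_comm]
    rw [him, realDn_add_half hr hκ, ← homPoint_mul_right (b * (_ ^ 2 + r ^ 2 * _ ^ 2)) (_ - (1 - r ^ 2) * _)
        (div_pos hr hD).ne']
    congr 2
    · field_simp
    · ring
  · rw [hsqrt hc (by rw [hlam₃, neg_neg]), mul_assoc Complex.I, ← Complex.ofReal_mul,
      ← Complex.ofReal_mul]
    rcases hsign h12 with h | h <;> rw [h]
    · rw [sphereMul_jacobiSn_of_re_eq_zero hk1 (by simp), if_neg hn]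
      have him : ((ellipticK k : ℂ) + Complex.I * (ellipticK (compModulus k) : ℂ) / 2
          + ((-1 : ℝ) : ℂ) * ((ellipticK k : ℂ) - Complex.I * (ellipticK (compModulus k) : ℂ) / 2)
          + Complex.I * (t : ℂ)).im = t + ellipticK (compModulus k) := by
        simp
        ring
      obtain ⟨g, hg, hS, hC⟩ := realSn_realCn_add_ellipticK hr hκ t
      rw [him, hS, hC,
        ← homPoint_mul_right _ (r * realSn _ t) (mul_ne_zero (neg_ne_zero.2 hr.ne') hg)]
      congr 2 <;> ring
    · rw [sphereMul_jacobiSn_of_re_eq_two_mul_ellipticK hk1 (by simp; ring), if_pos rfl]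
      have him : ((ellipticK k : ℂ) + Complex.I * (ellipticK (compModulus k) : ℂ) / 2
          + ((1 : ℝ) : ℂ) * ((ellipticK k : ℂ) - Complex.I * (ellipticK (compModulus k) : ℂ) / 2)
          + Complex.I * (t : ℂ)).im = t := by
        simp
      rw [him]
      congr 2
      ring
  · rw [hsqrt he (by rw [hmu₃, neg_neg]), mul_assoc Complex.I, ← Complex.ofReal_mul,
      ← Complex.ofReal_mul]
    rcases hsign h34 with h | h <;> rw [h]
    · rw [sphereMul_jacobiSn_of_re_eq_two_mul_ellipticK hk1 (by simp; ring), if_neg hn]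
      have him : ((ellipticK k : ℂ)
          - ((-1 : ℝ) : ℂ) * ((ellipticK k : ℂ) - Complex.I * (ellipticK (compModulus k) : ℂ) / 2)
          + Complex.I * (t : ℂ)).im = t - ellipticK (compModulus k) / 2 := by
        simp
        ring
      obtain ⟨g, hg, hS, hC⟩ := realSn_realCn_sub_half hr hκ t
      have hs12 : Real.sign (nu₁ * nu₂) ≠ 0 := by rwa [Ne, Real.sign_eq_zero_iff]
      have hw := num_ne_zero_or_den_ne_zero hr hsc hd hd0
      have hw' := num_ne_zero_or_den_ne_zero (s := -realSn (compModulus k) t)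
        (c := realCn (compModulus k) t) hr (by rwa [neg_sq])
        (by rwa [neg_sq]) hd0
      rw [him, hS, hC]
      generalize realSn (compModulus k) t = S at *
      generalize realCn (compModulus k) t = C at *
      generalize realDn (compModulus k) t = d at *
      -- shifting by `-K' / 2` gives `[r² S - C d : C + S d]`, which is the same point as `[-q : p]`
      have hw'' : r ^ 2 * S - C * d ≠ 0 ∨ C + S * d ≠ 0 := by
        refine hw'.imp (fun h h' => h ?_) (fun h h' => h ?_)
        · linear_combination -h'
        · linear_combination h'
      rw [show Real.sign (nu₁ * nu₂) * (e * r) * ((r ^ 2 * S - C * d) * g)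
          = Real.sign (nu₁ * nu₂) * e * (r ^ 2 * S - C * d) * (r * g) by ring,
        homPoint_mul_right _ _ (mul_ne_zero hr.ne' hg)]
      congr 1
      rw [homPoint_eq_homPoint_iff (mul_ne_zero_or (mul_ne_zero hs12 he.ne') hw'')
        (mul_ne_zero_or (mul_ne_zero (neg_ne_zero.2 hs12) he.ne') hw.symm)]
      linear_combination (Real.sign (nu₁ * nu₂) * e) * ((1 - d ^ 2) * hsc - hd)
    · rw [sphereMul_jacobiSn_of_re_eq_zero hk1 (by simp), if_pos rfl]
      have him : ((ellipticK k : ℂ)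
          - ((1 : ℝ) : ℂ) * ((ellipticK k : ℂ) - Complex.I * (ellipticK (compModulus k) : ℂ) / 2)
          + Complex.I * (t : ℂ)).im = t + ellipticK (compModulus k) / 2 := by
        simp
        ring
      obtain ⟨g, hg, hS, hC⟩ := realSn_realCn_add_half hr hκ t
      rw [him, hS, hC, ← homPoint_mul_right _ (realCn _ t - _) (mul_ne_zero hr.ne' hg)]
      congr 2
      ring

theorem sphereMul4_toSphere4_realBranch (ε α β γ δ r : ℝ) (P Q : Prop) [Decidable P] [Decidable Q]
    (φ : ℝ) : sphereMul4 ε (toSphere4 (realBranch α β γ δ r P Q φ))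
      = toSphere4 (realBranch (ε * α) (ε * β) (ε * γ) (ε * δ) r P Q φ) := by
  simp only [sphereMul4, toSphere4, realBranch]
  split_ifs <;> simp only [sphereMul_toSphere_homPoint, mul_assoc]

/-! ### The case `nu₂ = 0` and the reduction to normalized coefficients -/

/-- If `nu₂ = 0` then `z² = lam₁` along each curve of solutions, so that `z` is constant. -/
theorem not_hasNontrivialCurve_of_eq_zero {a b c e nu₁ nu₃ nu₄ : ℝ} (ha : 0 < a) (he : 0 < e) :
    ¬ HasNontrivialCurve (solutionSet (a ^ 2) (b ^ 2) (-c ^ 2) (-e ^ 2) nu₁ 0 nu₃ nu₄) := by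
  rintro ⟨γ, ⟨hγ, hz, -, -, -⟩, hmem⟩
  have hc : IsPreconnected ((fun t => (γ t).1) '' Icc (0 : ℝ) 1) :=
    isPreconnected_Icc.image _ (continuous_fst.comp_continuousOn hγ)
  refine hc.infinite_of_nontrivial hz
    (Set.Finite.subset (Set.toFinite {homPoint (a * 1) 1, homPoint (a * -1) 1}) ?_)
  rintro _ ⟨t, ht, rfl⟩
  have h := (hmem t ht).2.1
  dsimp only
  obtain ⟨z, z', hz, hz1⟩ := exists_eq_homPoint_mul (γ t).1 ha.ne'
  obtain ⟨w, w', hw, hw1⟩ := exists_eq_homPoint_mul (γ t).2.2.2 he.ne'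
  rw [hz1, hw1, biquadraticEq_homPoint_mul_iff (-1) 1 0 ha.ne' he.ne' (by ring) (by ring) (by ring)
    hz hw] at h
  have hw2 : 0 < w ^ 2 + 1 * w' ^ 2 := by rcases hw with h | h <;> positivity
  have h1 : (z - z') * (z + z') = 0 := by
    apply mul_right_cancel₀ hw2.ne'
    linear_combination h
  rw [hz1, mem_insert_iff, mem_singleton_iff, homPoint_eq_homPoint_iff (mul_ne_zero_or ha.ne' hz)
    (.inr one_ne_zero), homPoint_eq_homPoint_iff (mul_ne_zero_or ha.ne' hz) (.inr one_ne_zero)]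
  exact (mul_eq_zero.1 h1).imp (fun h => by linear_combination a * h)
    (fun h => by linear_combination a * h)

theorem eq_sign_mul_of_sq_eq {x y : ℝ} (hy : 0 < y) (h : x ^ 2 = y ^ 2) :
    x = Real.sign x * y ∧ (Real.sign x = -1 ∨ Real.sign x = 1) := by
  rcases sq_eq_sq_iff_eq_or_eq_neg.1 h with rfl | rfl
  · simp [Real.sign_of_pos hy]
  · simp [Real.sign_of_neg (neg_neg_of_pos hy)]

theorem sign_mul_of_signs {x y : ℝ} (hx : Real.sign x = -1 ∨ Real.sign x = 1)
    (hy : Real.sign y = -1 ∨ Real.sign y = 1) :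
    Real.sign (x * y) = Real.sign x * Real.sign y := by
  have h : ∀ {x : ℝ}, Real.sign x = -1 ∨ Real.sign x = 1 → x ≠ 0 := by
    rintro x h rfl
    simp at h
  rcases lt_or_gt_of_ne (h hx) with hx | hx <;> rcases lt_or_gt_of_ne (h hy) with hy | hy
  · rw [Real.sign_of_neg hx, Real.sign_of_neg hy, Real.sign_of_pos (mul_pos_of_neg_of_neg hx hy)]
    norm_num
  · rw [Real.sign_of_neg hx, Real.sign_of_pos hy, Real.sign_of_neg (mul_neg_of_neg_of_pos hx hy)]
    norm_num
  · rw [Real.sign_of_pos hx, Real.sign_of_neg hy, Real.sign_of_neg (mul_neg_of_pos_of_neg hx hy)]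
    norm_num
  · rw [Real.sign_of_pos hx, Real.sign_of_pos hy, Real.sign_of_pos (mul_pos hx hy)]
    norm_num

theorem mainTheorem5
    (lam₁ lam₂ lam₃ lam₄ mu₁ mu₂ mu₃ mu₄ nu₁ nu₂ nu₃ nu₄ : ℝ)
    -- the involution factors at common vertices are opposite
    (hlam₁₂ : lam₁ = -lam₂) (hmu₁₄ : mu₁ = -mu₄) (hmu₂₃ : mu₂ = -mu₃) (hlam₃₄ : lam₃ = -lam₄)
    -- proportionality of the resultants
    (h₁₃ : nu₁ ^ 2 / (lam₁ * mu₁) = nu₃ ^ 2 / (lam₃ * mu₃))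
    (h₂₄ : nu₂ ^ 2 / (lam₂ * mu₂) = nu₄ ^ 2 / (lam₄ * mu₄))
    (h₁₂ : nu₁ ^ 2 / (lam₁ * mu₁) + nu₂ ^ 2 / (lam₂ * mu₂) = 16)
    -- the sign pattern
    (hlam₁ : 0 < lam₁) (hmu₁ : 0 < mu₁) (hlam₃ : lam₃ < 0) (hmu₃ : mu₃ < 0) :
    let S := solutionSet lam₁ mu₁ lam₃ mu₃ nu₁ nu₂ nu₃ nu₄
    let ζ₁ : ℝ := |nu₁| / (4 * √(lam₁ * mu₁))
    (HasNontrivialCurve S ↔ 1 < ζ₁) ∧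
    (1 < ζ₁ →
      let k : ℝ := (ζ₁ - √(ζ₁ ^ 2 - 1)) ^ 2
      let I : Set ℝ := Set.Ico 0 (2 * ellipticK (compModulus k))
      let branch : ℝ → ℝ → ℝ → OnePoint ℂ × OnePoint ℂ × OnePoint ℂ × OnePoint ℂ :=
        fun ε σ t => sphereMul4 (ε : ℂ)
          (ellipticBranch lam₁ mu₁ lam₃ mu₃ nu₁ nu₂ nu₃ nu₄ k σ t)
      -- each of the four branches is a non-trivial curve
      (∀ ε ∈ ({1, -1} : Set ℝ), ∀ σ ∈ ({1, -1} : Set ℝ), IsNontrivialCurveOn (branch ε σ) I) ∧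
      -- every real solution lies on exactly one branch, at exactly one value of the parameter
      Set.BijOn (fun q : ℝ × ℝ × ℝ => branch q.1 q.2.1 q.2.2)
        (({1, -1} : Set ℝ) ×ˢ ({1, -1} : Set ℝ) ×ˢ I) (toSphere4 '' S)) := by
  intro S ζ
  obtain ⟨a, ha, hla⟩ : ∃ a : ℝ, 0 < a ∧ lam₁ = a ^ 2 :=
    ⟨√lam₁, Real.sqrt_pos.2 hlam₁, (Real.sq_sqrt hlam₁.le).symm⟩
  obtain ⟨b, hb, hmb⟩ : ∃ b : ℝ, 0 < b ∧ mu₁ = b ^ 2 :=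
    ⟨√mu₁, Real.sqrt_pos.2 hmu₁, (Real.sq_sqrt hmu₁.le).symm⟩
  obtain ⟨c, hc, hlc⟩ : ∃ c : ℝ, 0 < c ∧ lam₃ = -c ^ 2 :=
    ⟨√(-lam₃), Real.sqrt_pos.2 (by linarith), by rw [Real.sq_sqrt (by linarith), neg_neg]⟩
  obtain ⟨e, he, hme⟩ : ∃ e : ℝ, 0 < e ∧ mu₃ = -e ^ 2 :=
    ⟨√(-mu₃), Real.sqrt_pos.2 (by linarith), by rw [Real.sq_sqrt (by linarith), neg_neg]⟩
  have hζ : ζ = |nu₁| / (4 * (a * b)) := by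
    simp only [ζ]
    rw [hla, hmb, ← mul_pow, Real.sqrt_sq (by positivity)]
  have hζ0 : 0 ≤ ζ := by rw [hζ]; positivity
  have h1 : nu₁ ^ 2 / (lam₁ * mu₁) = 16 * ζ ^ 2 := by
    rw [hζ, hla, hmb, div_pow, sq_abs]
    field_simp
    norm_num
  rw [h1] at h₁₂ h₁₃
  have h2 : nu₂ ^ 2 / (lam₂ * mu₂) = 16 * (1 - ζ ^ 2) := by linarith
  rw [h2] at h₂₄
  obtain rfl : lam₂ = -lam₁ := by linarith
  obtain rfl : mu₄ = -mu₁ := by linarith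
  obtain rfl : lam₄ = -lam₃ := by linarith
  subst hmu₂₃ hla hmb hlc hme
  have hn1 : nu₁ ^ 2 = 16 * ζ ^ 2 * (a * b) ^ 2 := by
    field_simp at h1
    linarith
  have hn2 : nu₂ ^ 2 = 16 * (ζ ^ 2 - 1) * (a * e) ^ 2 := by
    field_simp at h2
    linarith
  have hn3 : nu₃ ^ 2 = 16 * ζ ^ 2 * (c * e) ^ 2 := by
    field_simp at h₁₃
    linarith
  have hn4 : nu₄ ^ 2 = 16 * (ζ ^ 2 - 1) * (c * b) ^ 2 := by
    field_simp at h₂₄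
    linarith
  by_cases h1ζ : 1 < ζ
  swap
  · refine ⟨iff_of_false ?_ h1ζ, fun h => absurd h h1ζ⟩
    have hn20 : nu₂ = 0 := by
      have h : (ζ ^ 2 - 1) * (a * e) ^ 2 ≤ 0 :=
        mul_nonpos_of_nonpos_of_nonneg (by nlinarith) (sq_nonneg _)
      exact pow_eq_zero_iff two_ne_zero |>.1 (le_antisymm (by linarith) (sq_nonneg _))
    simp only [S, hn20]
    exact not_hasNontrivialCurve_of_eq_zero ha he
  have hrad : 0 < ζ ^ 2 - 1 := by nlinarith
  obtain ⟨η, hη, hη2⟩ : ∃ η : ℝ, η = √(ζ ^ 2 - 1) ∧ η ^ 2 = ζ ^ 2 - 1 :=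
    ⟨_, rfl, Real.sq_sqrt hrad.le⟩
  have hη0 : 0 < η := hη ▸ Real.sqrt_pos.2 hrad
  obtain ⟨r, hrdef⟩ : ∃ r, r = ζ - η := ⟨_, rfl⟩
  have hrη : r * (ζ + η) = 1 := by rw [hrdef]; linear_combination -hη2
  have hr : 0 < r := pos_of_mul_pos_left (hrη ▸ one_pos) (by linarith)
  have hr1 : r < 1 := by nlinarith
  have hm : 2 * (1 + r ^ 2) / r = 4 * ζ := by
    field_simp
    rw [hrdef] at hrη ⊢
    linear_combination (-2) * hrη
  have hn : 2 * (1 - r ^ 2) / r = 4 * η := by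
    field_simp
    rw [hrdef] at hrη ⊢
    linear_combination (-2) * hrη
  obtain ⟨e1, s1⟩ := eq_sign_mul_of_sq_eq (y := a * b * (2 * (1 + r ^ 2) / r)) (x := nu₁)
    (by positivity) (by rw [hm, hn1]; ring)
  obtain ⟨e2, s2⟩ := eq_sign_mul_of_sq_eq (y := a * e * (2 * (1 - r ^ 2) / r)) (x := nu₂)
    (by rw [hn]; positivity) (by rw [hn, hn2, ← hη2]; ring)
  obtain ⟨e3, s3⟩ := eq_sign_mul_of_sq_eq (y := c * e * (2 * (1 + r ^ 2) / r)) (x := nu₃)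
    (by positivity) (by rw [hm, hn3]; ring)
  obtain ⟨e4, s4⟩ := eq_sign_mul_of_sq_eq (y := c * b * (2 * (1 - r ^ 2) / r)) (x := nu₄)
    (by rw [hn]; positivity) (by rw [hn, hn4, ← hη2]; ring)
  have s12 := sign_mul_of_signs s1 s2
  have s34 := sign_mul_of_signs s3 s4
  have hbij := bijOn_realBranch ha hb hc he hr hr1 s1 s2 s3 s4
  rw [← e1, ← e2, ← e3, ← e4] at hbij
  have hmem : ∀ {x : ℝ}, x ∈ ({1, -1} : Set ℝ) → x = -1 ∨ x = 1 := by
    intro x hx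
    simpa [or_comm] using hx
  have hne : ∀ {p x : ℝ}, (p = -1 ∨ p = 1) → 0 < x → p * x ≠ 0 := fun hp hx =>
    mul_ne_zero (ne_zero_of_sign hp) hx.ne'
  have hα : ∀ {ε : ℝ}, ε = -1 ∨ ε = 1 → ε * (Real.sign nu₁ * a) ≠ 0 := fun h =>
    mul_ne_zero (ne_zero_of_sign h) (hne s1 ha)
  have hβ : ∀ {ε : ℝ}, ε = -1 ∨ ε = 1 → ε * b ≠ 0 := fun h => hne h hb
  have hγ : ∀ {ε : ℝ}, ε = -1 ∨ ε = 1 → ε * (Real.sign nu₄ * c) ≠ 0 := fun h =>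
    mul_ne_zero (ne_zero_of_sign h) (hne s4 hc)
  have hδ : ∀ {ε : ℝ}, ε = -1 ∨ ε = 1 → ε * (-(Real.sign nu₁ * Real.sign nu₂) * e) ≠ 0 := fun h =>
    mul_ne_zero (ne_zero_of_sign h) (mul_ne_zero (neg_ne_zero.2
      (mul_ne_zero (ne_zero_of_sign s1) (ne_zero_of_sign s2))) he.ne')
  refine ⟨iff_of_true ?_ h1ζ, fun _ => ?_⟩
  · refine ⟨fun φ => realBranch (1 * (Real.sign nu₁ * a)) (1 * b) (1 * (Real.sign nu₄ * c))
      (1 * (-(Real.sign nu₁ * Real.sign nu₂) * e)) r (1 * (Real.sign nu₁ * Real.sign nu₂) = 1)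
      (1 * (Real.sign nu₃ * Real.sign nu₄) = 1) φ, ?_, fun φ hφ => ?_⟩
    · exact isNontrivialCurveOn_realBranch (hα (.inr rfl)) (hβ (.inr rfl)) (hγ (.inr rfl))
        (hδ (.inr rfl)) hr hr1 continuousOn_id ⟨0, by simp, rfl⟩ ⟨1, by simp, rfl⟩
    · exact hbij.mapsTo (x := (1, 1, φ)) ⟨by simp, by simp, hφ.1,
        by linarith [hφ.2, Real.pi_gt_three]⟩
  · intro k I branch
    have hk : k = r ^ 2 := by rw [hrdef, hη]
    have hk1 : k ^ 2 < 1 := by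
      rw [hk, ← pow_mul]
      exact pow_lt_one₀ hr.le hr1 (by norm_num)
    have hκ1 : compModulus k ^ 2 < 1 := by
      have : 0 < k := by rw [hk]; positivity
      rw [compModulus_sq hk1]
      have : 0 < k ^ 2 := by positivity
      linarith
    have hn12 : nu₁ * nu₂ ≠ 0 := fun h => by
      rw [h, Real.sign_zero] at s12
      exact mul_ne_zero (ne_zero_of_sign s1) (ne_zero_of_sign s2) s12.symm
    have hn34 : nu₃ * nu₄ ≠ 0 := fun h => by
      rw [h, Real.sign_zero] at s34
      exact mul_ne_zero (ne_zero_of_sign s3) (ne_zero_of_sign s4) s34.symm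
    have hbranch : ∀ {ε σ t : ℝ}, σ = -1 ∨ σ = 1 → branch ε σ t = toSphere4
        (realBranch (ε * (Real.sign nu₁ * a)) (ε * b) (ε * (Real.sign nu₄ * c))
          (ε * (-(Real.sign nu₁ * Real.sign nu₂) * e)) r
          (σ * (Real.sign nu₁ * Real.sign nu₂) = 1) (σ * (Real.sign nu₃ * Real.sign nu₄) = 1)
          (jacobiAm (compModulus k) t)) := fun {ε σ t} hσ => by
      simp only [branch]
      rw [ellipticBranch_eq ha hb hc he hr hr1 rfl rfl rfl rfl hk hn12 hn34 hσ,
        sphereMul4_toSphere4_realBranch, s12, s34]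
    have ham : BijOn (jacobiAm (compModulus k)) I (Ico 0 Real.pi) := bijOn_jacobiAm hκ1
    refine ⟨fun ε hε σ hσ => ?_, ?_⟩
    · have hfun : branch ε σ = fun t => toSphere4
        (realBranch (ε * (Real.sign nu₁ * a)) (ε * b) (ε * (Real.sign nu₄ * c))
          (ε * (-(Real.sign nu₁ * Real.sign nu₂) * e)) r
          (σ * (Real.sign nu₁ * Real.sign nu₂) = 1) (σ * (Real.sign nu₃ * Real.sign nu₄) = 1)
          (jacobiAm (compModulus k) t)) := funext fun t => hbranch (hmem hσ)
      rw [hfun]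
      refine (isNontrivialCurveOn_realBranch (hα (hmem hε)) (hβ (hmem hε)) (hγ (hmem hε))
        (hδ (hmem hε)) hr hr1 (continuous_jacobiAm hκ1).continuousOn ?_ ?_).map_toSphere4 <;>
        rw [ham.image_eq]
      · exact ⟨le_rfl, Real.pi_pos⟩
      · exact ⟨zero_le_one, by linarith [Real.pi_gt_three]⟩
    · have hpar : BijOn (Prod.map id (Prod.map id (jacobiAm (compModulus k))))
          (({1, -1} : Set ℝ) ×ˢ ({1, -1} : Set ℝ) ×ˢ I)
          (({1, -1} : Set ℝ) ×ˢ ({1, -1} : Set ℝ) ×ˢ Ico 0 Real.pi) :=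
        (bijOn_id _).prodMap ((bijOn_id _).prodMap ham)
      refine ((injective_toSphere4.injOn.bijOn_image.comp hbij).comp hpar).congr ?_
      rintro ⟨ε, σ, t⟩ ⟨-, hσ, -⟩
      exact (hbranch (hmem hσ)).symm
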